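/- **Setting.** Fix a finite set $\mathcal A$ of smooth computable activation functions $\mathbb R\to\mathbb R$. A *neural network* $\mathbb R^m\to\mathbb R^N$ is a map $y\mapsto W\,h(y)+Ry+c$, where $h$ is a finite composition of layers, each being an affine map followed by one function of $\mathcal A$ applied to some of the coordinates. Let $A:\mathbb R^N\to\mathbb R^m$ be linear. For $\mathcal M_1\subset\mathbb R^N$ let $c_{\mathrm{opt}}(A,\mathcal M_1)=\inf_{\varphi}\sup_{x\in\mathcal M_1}d^H(\varphi(Ax),\{x\})$, where $\varphi$ ranges over the multivalued maps $A(\mathcal M_1)\rightrightarrows\mathbb R^N$ and $d^H$ is the Hausdorff distance; $\mathbf N$ is *optimal* for $(A,\mathcal M_1)$ if $\sup_{x\in\mathcal M_1}\|\mathbf N(Ax)-x\|_{\ell^2}\le c_{\mathrm{opt}}(A,\mathcal M_1)$. A *collection of training problems of size $\ell$* is a set $\Omega$ of training sets $\mathcal T=\{(x_j,Ax_j)\}$ with $|\mathcal T|=\ell$ and $\|x_j\|_{\ell^2},\|Ax_j\|_{\ell^2}\le 1$, together with, for each $\mathcal T\in\Omega$, an initial domain $\mathcal M_1(\mathcal T)\subset\mathbb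 R^N$ containing all $x_j$. Put $Y=\bigcup_{\mathcal T\in\Omega}A(\mathcal M_1(\mathcal T))$, and let $\mathcal{NN}_{m,N}$ be the set of neural networks that are bounded on $Y$. Define $$\Xi(\mathcal T)=\{\mathbf N\in\mathcal{NN}_{m,N}:\mathbf N\text{ is optimal for }(A,\mathcal M_1(\mathcal T))\},$$ $$\Xi_D(\mathcal T)=\{\mathbf N\in\Xi(\mathcal T):\|\mathrm D\mathbf N(y)\|_{op}\le D\ \ \forall y\in A(\mathcal M_1(\mathcal T))\}.$$ An algorithm receives $\mathcal T$ (its elements being ordered lexicographically) through an oracle which returns, for each coordinate of each element and each $n\in\mathbb N$, a dyadic number in $2^{-n}\mathbb Z$ within $2^{-n}$ of that coordinate; it has to work for every such oracle. Its output $\mathbf N$ is an *$\epsilon$-approximation* for problem a if $\inf_{\mathbf N'\in\Xi(\mathcal T)}\sup_{y\in Y}\|\mathbf N(y)-\mathbf N'(y)\|_{\ell^2}\le\epsilon$, and for problem b (with parameter $D$) if $$\inf_{\mathbf N'\in\Xi_D(\mathcal T)}\ \sup_{y\in Y}\ \max\bigl(\|\mathbf N(y)-\mathbf N'(y)\|_{\ell^2},\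 \|\mathrm D\mathbf N(y)-\mathrm D\mathbf N'(y)\|_{op}\bigr)\le\epsilon .$$ Positive statements refer to Turing algorithms with oracle, which output a finite description of a network with rational weights. Negative statements refer to *general algorithms* (maps from the inputs to outputs or "does not halt" whose value and whose set of queries depend only on the answers to their queries, and which make finitely many queries when they halt) and to *randomised general algorithms* (sets of general algorithms with a $\sigma$-algebra and probability measures $\mathbb P_\iota$ indexed by the inputs $\iota$, such that outputs and runtimes are measurable, and $\mathbb P_\iota(E)=\mathbb P_{\iota'}(E)$ for every event $E$ all of whose algorithms read, on input $\iota$, only evaluations on which $\iota$ and $\iota'$ agree). These may fail to halt. For $\epsilon>0$ let $S_1^a(\epsilon)$ (resp. $S_1^b(\epsilon)$) be the class of problems for which a Turing algorithm computes $\epsilon$-approximations on all inputs; $S_2^a(\epsilon)$ the class of those for which no randomised general algorithm produces, on every input, an $\epsilon$-approximation with probability $>1/2$; $S_2^b(\epsilon)$ the class of those for which no general algorithm computes $\epsilon$-approximations on all inputs. For families of classes with $S_1(\epsilon)\cap S_2(\epsilon)=\emptyset$ and $\epsilon_1\ge\epsilon_2>0$, a problem has an *$(S_1,S_2)$-phase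 transition at $(\epsilon_1,\epsilon_2)$* if it is in $S_1(\epsilon)$ for all $\epsilon>\epsilon_1$ and in $S_2(\epsilon)$ for all $0<\epsilon<\epsilon_2$; it is *sharp at $\epsilon_1$* if $\epsilon_1=\epsilon_2$. **Theorem.** There is a finite set $\mathcal A$ of smooth computable activation functions such that the following holds. Let $N>m$ be natural numbers, $\beta_{max}\ge\beta_{min}>0$, and let $A:\mathbb R^N\to\mathbb R^m$ be a non-zero linear map with $\mathrm{Sp}(AA^*)\subset[\beta_{min}^2,\beta_{max}^2]$. Then for every rational $\epsilon_1\in(0,3/8]$ and every integer $\ell\ge2$ there is a collection of training problems of size $\ell$ for $A$ such that 1. problem a has an $(S_1^a,S_2^a)$-phase transition at $(2\epsilon_1,\epsilon_1)$: it is in $S_1^a(\epsilon)$ for $\epsilon>2\epsilon_1$ and in $S_2^a(\epsilon)$ for $0<\epsilon<\epsilon_1$; and 2. there is an integer $D\geq 1$ such that problem b with this $D$ has a sharp $(S_1^b,S_2^b)$-phase transition at $2\epsilon_1$. -/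

import Mathlib

open scoped ENNReal ContDiff
open MeasureTheory

noncomputable section

/-! ### Computational problems, general algorithms and inexact input -/

/-- A computational problem: a domain `Dom`, a countable evaluation set `(eval i)` of real valued
functions separating the points of the domain, a (pseudo)metric space `Out` of outputs and a
multivalued problem function `sol`. The field `name` is the notation system for outputs that a
Turing machine uses: `name k` is the element of `Out`, if any, described by the natural number
(finite string) `k`. -/
structure CompProblem where
  Dom : Type
  Idx : Type
  enc : Encodable Idx
  eval : Idx → Dom → ℝ
  separates : ∀ a b : Dom, (∀ i, eval i a = eval i b) → a = b
  Out : Type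
  metric : PseudoEMetricSpace Out
  sol : Dom → Set Out
  name : ℕ → Option Out

namespace CompProblem

instance instEncodableIdx (P : CompProblem) : Encodable P.Idx := P.enc

instance instMetricOut (P : CompProblem) : PseudoEMetricSpace P.Out := P.metric

/-- The output `r` of an algorithm (`none` stands for "does not halt") on the input `a` is an
output whose distance to the solution set is at most `ε`. -/
def Approximates (P : CompProblem) (ε : ℝ) (a : P.Dom) (r : Option P.Out) : Prop :=
  ∃ x : P.Out, r = some x ∧ Metric.infEDist x (P.sol a) ≤ ENNReal.ofReal ε

/-- A family `o i n` of integers such that the dyadic number `o i n / 2 ^ n` is within `2 ^ (-n)`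
of the `i`-th evaluation of `a`. -/
def IsInexact (P : CompProblem) (a : P.Dom) (o : P.Idx → ℕ → ℤ) : Prop :=
  ∀ i n, |(o i n : ℝ) / 2 ^ n - P.eval i a| ≤ 1 / 2 ^ n

/-- The inexact inputs: points of the domain together with a sequence of dyadic approximations of
all evaluations (the point is determined by the sequence). -/
def InexactDom (P : CompProblem) : Type :=
  {p : P.Dom × (P.Idx → ℕ → ℤ) // P.IsInexact p.1 p.2}

theorem IsInexact.unique {P : CompProblem} {a b : P.Dom} {o : P.Idx → ℕ → ℤ}
    (ha : P.IsInexact a o) (hb : P.IsInexact b o) : a = b := by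
  refine P.separates a b fun i => ?_
  have h : ∀ n : ℕ, |P.eval i a - P.eval i b| ≤ 2 * (1 / 2) ^ n := fun n => by
    have h1 := ha i n
    have h2 := hb i n
    rw [one_div_pow, two_mul]
    rw [abs_le] at *
    constructor <;> linarith [h1.1, h1.2, h2.1, h2.2]
  have hlim : Filter.Tendsto (fun n : ℕ => 2 * (1 / 2 : ℝ) ^ n) Filter.atTop (nhds (2 * 0)) :=
    (tendsto_pow_atTop_nhds_zero_of_lt_one (by norm_num) (by norm_num)).const_mul 2
  have h0 := ge_of_tendsto' hlim h
  rw [mul_zero] at h0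
  exact sub_eq_zero.mp (abs_eq_zero.mp (le_antisymm h0 (abs_nonneg _)))

/-- The computational problem with `Δ₁`-information associated with `P`. -/
def delta1 (P : CompProblem) : CompProblem where
  Dom := P.InexactDom
  Idx := P.Idx × ℕ
  enc := inferInstance
  eval := fun q p => (p.1.2 q.1 q.2 : ℝ) / 2 ^ q.2
  separates := by
    intro p p' h
    have ho : p.1.2 = p'.1.2 := by
      funext i n
      have h2 : (2 : ℝ) ^ n ≠ 0 := by positivity
      exact_mod_cast (div_left_inj' h2).mp (h (i, n))
    have ha : p.1.1 = p'.1.1 := IsInexact.unique p.2 (by rw [ho]; exact p'.2)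
    exact Subtype.ext (Prod.ext ha ho)
  Out := P.Out
  metric := P.metric
  sol := fun p => P.sol p.1.1
  name := P.name

end CompProblem

/-- A general algorithm, with the value `none` for "does not halt"; `queries a` is the set of
evaluations that the algorithm reads on input `a`, which is finite whenever the algorithm halts. -/
structure GeneralAlgorithm (P : CompProblem) where
  run : P.Dom → Option P.Out
  queries : P.Dom → Set P.Idx
  finite_queries : ∀ a, run a ≠ none → (queries a).Finite
  run_eq : ∀ a b, (∀ i ∈ queries a, P.eval i b = P.eval i a) → run b = run a
  queries_eq : ∀ a b, (∀ i ∈ queries a, P.eval i b = P.eval i a) → queries b = queries a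

/-- The runtime of a general algorithm: the largest index of an evaluation that is read. -/
def GeneralAlgorithm.runtime {P : CompProblem} (Γ : GeneralAlgorithm P) (a : P.Dom) : ℕ∞ :=
  ⨆ i ∈ Γ.queries a, (Encodable.encode i : ℕ∞)

/-- The Borel sigma-algebra of `Out ∪ {NH}`, where the non-halting value is an isolated point. -/
@[reducible]
def CompProblem.outBorel (P : CompProblem) : MeasurableSpace (Option P.Out) :=
  (borel P.Out).map some

/-- A randomised general algorithm: a set `X` of general algorithms with a sigma-algebra and a
family of probability measures indexed by the inputs. -/
structure RandomisedGeneralAlgorithm (P : CompProblem) where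
  X : Set (GeneralAlgorithm P)
  sigma : MeasurableSpace X
  prob : P.Dom → Measure X
  isProb : ∀ a, IsProbabilityMeasure (prob a)
  measurable_run : ∀ a, @Measurable X (Option P.Out) sigma P.outBorel fun Γ => Γ.1.run a
  measurable_runtime : ∀ (n : ℕ) (a : P.Dom), MeasurableSet {Γ : X | Γ.1.runtime a ≤ n}
  consistent : ∀ (a b : P.Dom) (E : Set X), MeasurableSet E →
    (∀ Γ ∈ E, ∀ i ∈ Γ.1.queries a, P.eval i a = P.eval i b) → prob a E = prob b E

/-! ### Turing algorithms with an oracle -/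

/-- Programs for partial recursive functions with one oracle instruction `query`. -/
inductive OracleCode : Type
  | zero : OracleCode
  | succ : OracleCode
  | left : OracleCode
  | right : OracleCode
  | query : OracleCode
  | pair : OracleCode → OracleCode → OracleCode
  | comp : OracleCode → OracleCode → OracleCode
  | prec : OracleCode → OracleCode → OracleCode
  | rfind : OracleCode → OracleCode

/-- The partial function computed by a program with the oracle `o`. -/
def OracleCode.eval (o : ℕ → ℕ) : OracleCode → ℕ →. ℕ
  | zero => fun _ => Part.some 0
  | succ => fun n => Part.some (n + 1)
  | left => fun n => Part.some n.unpair.1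
  | right => fun n => Part.some n.unpair.2
  | query => fun n => Part.some (o n)
  | pair cf cg => fun n =>
      (eval o cf n).bind fun a => (eval o cg n).map fun b => Nat.pair a b
  | comp cf cg => fun n => (eval o cg n).bind (eval o cf)
  | prec cf cg => fun p =>
      Nat.rec (eval o cf p.unpair.1)
        (fun y ih => ih.bind fun i => eval o cg (Nat.pair p.unpair.1 (Nat.pair y i))) p.unpair.2
  | rfind cf => fun a =>
      Nat.rfind fun n => (eval o cf (Nat.pair a n)).map fun k => decide (k = 0)

/-- The oracle tape of an inexact input: on (the code of) `(i, n)` the oracle returns the code of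
the integer `o i n`, that is, of the dyadic number `o i n / 2 ^ n`. -/
def CompProblem.oracle (P : CompProblem) (p : P.InexactDom) : ℕ → ℕ := fun q =>
  match (Encodable.decode q : Option (P.Idx × ℕ)) with
  | some (i, n) => Encodable.encode (p.1.2 i n)
  | none => 0

/-! ### Classes of approximate computational problems and phase transitions -/

/-- The problems `P` for which some (Turing) algorithm computes `ε`-approximations to solutions
from every inexact input. -/
def TuringComputable (ε : ℝ) : Set CompProblem :=
  {P | ∃ c : OracleCode, ∀ p : P.InexactDom, ∃ k ∈ c.eval (P.oracle p) 0,
    P.Approximates ε p.1.1 (P.name k)}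

/-- The problems `P` for which no general algorithm computes `ε`-approximations to solutions from
every inexact input. -/
def NotComputable (ε : ℝ) : Set CompProblem :=
  {P | ¬ ∃ Γ : GeneralAlgorithm P.delta1, ∀ p, P.delta1.Approximates ε p (Γ.run p)}

/-- The problems `P` for which no randomised general algorithm computes `ε`-approximations to
solutions with probability greater than `1 / 2` on every inexact input. -/
def NotRandomisedComputable (ε : ℝ) : Set CompProblem :=
  {P | ¬ ∃ R : RandomisedGeneralAlgorithm P.delta1, ∀ p,
    1 / 2 < R.prob p {Γ | P.delta1.Approximates ε p (Γ.1.run p)}}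

/-- The `(S₁, S₂)`-phase transition at `(ε₁, ε₂)`, where `S₁ ε` and `S₂ ε` are disjoint classes of
`ε`-approximate computational problems. -/
def HasPhaseTransition (S₁ S₂ : ℝ → Set CompProblem) (P : CompProblem) (ε₁ ε₂ : ℝ) : Prop :=
  (∀ ε, 0 < ε → Disjoint (S₁ ε) (S₂ ε)) ∧ 0 < ε₂ ∧ ε₂ ≤ ε₁ ∧
    (∀ ε, ε₁ < ε → P ∈ S₁ ε) ∧ ∀ ε, 0 < ε → ε < ε₂ → P ∈ S₂ ε

/-- A phase transition that is sharp at the approximation threshold `ε₁`. -/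
def HasSharpPhaseTransition (S₁ S₂ : ℝ → Set CompProblem) (P : CompProblem) (ε₁ : ℝ) : Prop :=
  HasPhaseTransition S₁ S₂ P ε₁ ε₁

/-! ### Neural networks -/

/-- A function `f : ℝ → ℝ` is computable: its values at rational points can be computed to any
precision, and it has a computable modulus of uniform continuity on bounded intervals. -/
def IsComputableRealFun (f : ℝ → ℝ) : Prop :=
  (∃ g : ℤ × ℕ × ℕ → ℤ, Computable g ∧
    ∀ (p : ℤ) (q n : ℕ), |f ((p : ℝ) / (q + 1)) - (g (p, q, n) : ℝ) / 2 ^ n| ≤ 1 / 2 ^ n) ∧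
  ∃ h : ℕ × ℕ → ℕ, Computable h ∧ ∀ (M n : ℕ) (x y : ℝ), |x| ≤ M → |y| ≤ M →
    |x - y| ≤ 1 / 2 ^ h (M, n) → |f x - f y| ≤ 1 / 2 ^ n

/-- A finite collection of smooth computable activation functions. -/
structure Activations where
  size : ℕ
  fn : Fin size → ℝ → ℝ
  computable : ∀ j, IsComputableRealFun (fn j)
  smooth : ∀ j, ContDiff ℝ ∞ (fn j)

/-- The Euclidean space `ℝⁿ`. -/
abbrev RVec (n : ℕ) : Type := EuclideanSpace ℝ (Fin n)

/-- A hidden layer `ℝᵃ → ℝᵇ`: an affine map followed by one activation function, which is applied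
to the coordinates in the set `active`. -/
structure HiddenLayer (𝒜 : Activations) (a b : ℕ) where
  W : Matrix (Fin b) (Fin a) ℝ
  bias : Fin b → ℝ
  active : Set (Fin b)
  act : Fin 𝒜.size

open Classical in
def HiddenLayer.apply {𝒜 : Activations} {a b : ℕ} (L : HiddenLayer 𝒜 a b) (x : Fin a → ℝ) :
    Fin b → ℝ := fun k =>
  if k ∈ L.active then 𝒜.fn L.act ((L.W.mulVec x + L.bias) k) else (L.W.mulVec x + L.bias) k

/-- A composition of finitely many hidden layers. -/
inductive HiddenLayers (𝒜 : Activations) : ℕ → ℕ → Type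
  | nil (a : ℕ) : HiddenLayers 𝒜 a a
  | cons {a b c : ℕ} : HiddenLayer 𝒜 a b → HiddenLayers 𝒜 b c → HiddenLayers 𝒜 a c

def HiddenLayers.apply {𝒜 : Activations} : {a b : ℕ} → HiddenLayers 𝒜 a b →
    (Fin a → ℝ) → (Fin b → ℝ)
  | _, _, .nil _ => fun x => x
  | _, _, .cons L Ls => fun x => Ls.apply (L.apply x)

/-- A neural network `ℝᵐ → ℝᴺ`: hidden layers followed by an affine output layer with a skip
connection `R` from the input. -/
structure NeuralNetwork (𝒜 : Activations) (m N : ℕ) where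
  width : ℕ
  hidden : HiddenLayers 𝒜 m width
  W : Matrix (Fin N) (Fin width) ℝ
  R : Matrix (Fin N) (Fin m) ℝ
  bias : Fin N → ℝ

/-- The function computed by a neural network. -/
def NeuralNetwork.toFun {𝒜 : Activations} {m N : ℕ} (Φ : NeuralNetwork 𝒜 m N) :
    RVec m → RVec N := fun y =>
  WithLp.toLp 2 (Φ.W.mulVec (Φ.hidden.apply y.ofLp) + Φ.R.mulVec y.ofLp + Φ.bias)

/-! ### Finite descriptions of neural networks with rational weights -/

/-- The code `(p, q)` of the rational number `p / (q + 1)`. -/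
abbrev RatCode : Type := ℤ × ℕ

def RatCode.value (r : RatCode) : ℝ := (r.1 : ℝ) / (r.2 + 1)

/-- A neuron: weights, bias and whether the activation function is applied; a layer: the list of
its neurons and the index of the activation function. -/
abbrev LayerCode : Type := List (List RatCode × RatCode × Bool) × ℕ

/-- A network: the hidden layers, and for every output coordinate the weights, the weights of the
skip connection and the bias. -/
abbrev NetworkCode : Type := List LayerCode × List (List RatCode × List RatCode × RatCode)

/-- The `j`-th weight in a list; missing weights are zero. -/
def weightAt (l : List RatCode) (j : ℕ) : ℝ := (l.getD j (0, 0)).value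

def LayerCode.layer {𝒜 : Activations} (a : ℕ) (l : LayerCode) (h : l.2 < 𝒜.size) :
    HiddenLayer 𝒜 a l.1.length where
  W := Matrix.of fun i j => weightAt (l.1.get i).1 j
  bias := fun i => (l.1.get i).2.1.value
  active := {i | (l.1.get i).2.2 = true}
  act := ⟨l.2, h⟩

def LayerCode.layers (𝒜 : Activations) : (a : ℕ) → List LayerCode →
    Option (Σ b : ℕ, HiddenLayers 𝒜 a b)
  | a, [] => some ⟨a, .nil a⟩
  | a, l :: ls =>
      if h : l.2 < 𝒜.size then
        (LayerCode.layers 𝒜 l.1.length ls).map fun H => ⟨H.1, .cons (l.layer a h) H.2⟩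
      else none

def NetworkCode.network (𝒜 : Activations) (m N : ℕ) (c : NetworkCode) :
    Option (NeuralNetwork 𝒜 m N) :=
  (LayerCode.layers 𝒜 m c.1).map fun H =>
    { width := H.1
      hidden := H.2
      W := Matrix.of fun i j => weightAt (c.2.getD i ([], [], (0, 0))).1 j
      R := Matrix.of fun i j => weightAt (c.2.getD i ([], [], (0, 0))).2.1 j
      bias := fun i => (c.2.getD i ([], [], (0, 0))).2.2.value }

/-! ### The spaces of neural networks -/

/-- The neural networks `ℝᵐ → ℝᴺ`, as functions, that are bounded on the set `Y`. -/
def NNSpace (𝒜 : Activations) (m N : ℕ) (Y : Set (RVec m)) : Type :=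
  {f : RVec m → RVec N // (∃ Φ : NeuralNetwork 𝒜 m N, f = Φ.toFun) ∧ Bornology.IsBounded (f '' Y)}

open Classical in
/-- The network described by the number `k`. -/
def NNSpace.ofCode (𝒜 : Activations) (m N : ℕ) (Y : Set (RVec m)) (k : ℕ) :
    Option (NNSpace 𝒜 m N Y) :=
  ((Encodable.decode k : Option NetworkCode).bind (NetworkCode.network 𝒜 m N)).bind fun Φ =>
    if h : Bornology.IsBounded (Φ.toFun '' Y) then some ⟨Φ.toFun, ⟨Φ, rfl⟩, h⟩ else none

/-- The (pseudo)metric `sup_{y ∈ Y} ‖f y - g y‖`. -/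
@[reducible]
def NNSpace.supMetric (𝒜 : Activations) (m N : ℕ) (Y : Set (RVec m)) :
    PseudoEMetricSpace (NNSpace 𝒜 m N Y) where
  edist f g := ⨆ y ∈ Y, edist (f.1 y) (g.1 y)
  edist_self f := by simp
  edist_comm f g := by simp only [edist_comm]
  edist_triangle f g h := by
    refine iSup₂_le fun y hy => (edist_triangle _ (g.1 y) _).trans (add_le_add ?_ ?_)
    · exact le_iSup₂ (f := fun y (_ : y ∈ Y) => edist (f.1 y) (g.1 y)) y hy
    · exact le_iSup₂ (f := fun y (_ : y ∈ Y) => edist (g.1 y) (h.1 y)) y hy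

/-- The (pseudo)metric `sup_{y ∈ Y} max (‖f y - g y‖, ‖D f y - D g y‖)`, with the operator norm on
the Jacobians. -/
@[reducible]
def NNSpace.supJacobianMetric (𝒜 : Activations) (m N : ℕ) (Y : Set (RVec m)) :
    PseudoEMetricSpace (NNSpace 𝒜 m N Y) where
  edist f g := ⨆ y ∈ Y, max (edist (f.1 y) (g.1 y)) (edist (fderiv ℝ f.1 y) (fderiv ℝ g.1 y))
  edist_self f := by simp
  edist_comm f g := by simp only [edist_comm]
  edist_triangle f g h := by
    have key : ∀ u v : NNSpace 𝒜 m N Y, ∀ y ∈ Y,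
        max (edist (u.1 y) (v.1 y)) (edist (fderiv ℝ u.1 y) (fderiv ℝ v.1 y)) ≤
        ⨆ y ∈ Y, max (edist (u.1 y) (v.1 y)) (edist (fderiv ℝ u.1 y) (fderiv ℝ v.1 y)) :=
      fun u v y hy => le_iSup₂ (f := fun y (_ : y ∈ Y) =>
        max (edist (u.1 y) (v.1 y)) (edist (fderiv ℝ u.1 y) (fderiv ℝ v.1 y))) y hy
    refine iSup₂_le fun y hy => max_le ?_ ?_
    · exact (edist_triangle _ (g.1 y) _).trans (add_le_add
        ((le_max_left _ _).trans (key f g y hy)) ((le_max_left _ _).trans (key g h y hy)))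
    · exact (edist_triangle _ (fderiv ℝ g.1 y) _).trans (add_le_add
        ((le_max_right _ _).trans (key f g y hy)) ((le_max_right _ _).trans (key g h y hy)))

/-! ### Inverse problems, optimal maps and training sets -/

/-- The optimality constant of `(A, M)`: the infimum over all multivalued maps `φ` of the worst
Hausdorff distance between `φ (A x)` and `{x}`. -/
def optConst {N m : ℕ} (A : RVec N →L[ℝ] RVec m) (M : Set (RVec N)) : ℝ≥0∞ :=
  ⨅ φ : RVec m → Set (RVec N), ⨆ x ∈ M, Metric.hausdorffEDist (φ (A x)) {x}

/-- The map `f` is optimal for the inverse problem `(A, M)`. -/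
def IsOptimalMap {N m : ℕ} (A : RVec N →L[ℝ] RVec m) (M : Set (RVec N)) (f : RVec m → RVec N) :
    Prop :=
  ⨆ x ∈ M, Metric.hausdorffEDist {f (A x)} {x} ≤ optConst A M

/-- A collection `Ω` of training sets `T = {(x_j, A x_j)}` with `ℓ` elements in the product of the
closed unit balls, and for each of them an inverse problem `(A, M₁ T)` whose initial domain `M₁ T`
contains the points `x_j`. -/
structure TrainingProblem {N m : ℕ} (A : RVec N →L[ℝ] RVec m) (ℓ : ℕ) where
  Ω : Set (Finset (RVec N × RVec m))
  M₁ : Finset (RVec N × RVec m) → Set (RVec N)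
  card_eq : ∀ T ∈ Ω, T.card = ℓ
  norm_le : ∀ T ∈ Ω, ∀ p ∈ T, ‖p.1‖ ≤ 1 ∧ ‖p.2‖ ≤ 1
  mem_domain : ∀ T ∈ Ω, ∀ p ∈ T, p.1 ∈ M₁ T ∧ p.2 = A p.1

/-- The union of the measurement sets `A (M₁ T)` of all the inverse problems. -/
def TrainingProblem.measurements {N m : ℕ} {A : RVec N →L[ℝ] RVec m} {ℓ : ℕ}
    (𝒮 : TrainingProblem A ℓ) : Set (RVec m) :=
  ⋃ T ∈ 𝒮.Ω, A '' 𝒮.M₁ T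

/-- Pairs of vectors with the lexicographic order of their coordinates. -/
def lexEquiv (N m : ℕ) : RVec N × RVec m ≃ Lex (Lex (Fin N → ℝ) × Lex (Fin m → ℝ)) where
  toFun p := toLex (toLex p.1.ofLp, toLex p.2.ofLp)
  invFun q := (WithLp.toLp 2 (ofLex (ofLex q).1), WithLp.toLp 2 (ofLex (ofLex q).2))
  left_inv _ := rfl
  right_inv _ := rfl

/-- The `k`-th element of a training set in the lexicographic order. -/
def lexElem {N m ℓ : ℕ} (T : Finset (RVec N × RVec m)) (h : T.card = ℓ) (k : Fin ℓ) :
    RVec N × RVec m :=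
  (lexEquiv N m).symm
    ((T.map (lexEquiv N m).toEmbedding).orderEmbOfFin (by rw [Finset.card_map, h]) k)

theorem lexElem_injective {N m ℓ : ℕ} {T T' : Finset (RVec N × RVec m)} (h : T.card = ℓ)
    (h' : T'.card = ℓ) (H : ∀ k, lexElem T h k = lexElem T' h' k) : T = T' := by
  apply Finset.map_injective (lexEquiv N m).toEmbedding
  apply Finset.coe_injective
  have hT : (T.map (lexEquiv N m).toEmbedding).card = ℓ := by rw [Finset.card_map, h]
  have hT' : (T'.map (lexEquiv N m).toEmbedding).card = ℓ := by rw [Finset.card_map, h']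
  rw [← Finset.range_orderEmbOfFin _ hT, ← Finset.range_orderEmbOfFin _ hT']
  congr 1
  funext k
  exact (lexEquiv N m).symm.injective (H k)

/-- The evaluations: the coordinates of the `k`-th pair `(x, y)` of a training set. -/
def TrainingProblem.coord {N m : ℕ} {A : RVec N →L[ℝ] RVec m} {ℓ : ℕ} (𝒮 : TrainingProblem A ℓ)
    (i : Fin ℓ × (Fin N ⊕ Fin m)) (T : 𝒮.Ω) : ℝ :=
  match i with
  | (k, Sum.inl j) => (lexElem T.1 (𝒮.card_eq T.1 T.2) k).1 j
  | (k, Sum.inr j) => (lexElem T.1 (𝒮.card_eq T.1 T.2) k).2 j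

theorem TrainingProblem.coord_separates {N m : ℕ} {A : RVec N →L[ℝ] RVec m} {ℓ : ℕ}
    (𝒮 : TrainingProblem A ℓ) (T T' : 𝒮.Ω) (h : ∀ i, 𝒮.coord i T = 𝒮.coord i T') : T = T' := by
  apply Subtype.ext
  refine lexElem_injective (𝒮.card_eq T.1 T.2) (𝒮.card_eq T'.1 T'.2) fun k => Prod.ext ?_ ?_
  · ext j
    exact h (k, Sum.inl j)
  · ext j
    exact h (k, Sum.inr j)

/-- The set `Ξ(T)` of the neural networks that are optimal for `(A, M₁ T)`. -/
def TrainingProblem.optimalNets {N m : ℕ} {A : RVec N →L[ℝ] RVec m} {ℓ : ℕ}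
    (𝒮 : TrainingProblem A ℓ) (𝒜 : Activations) (T : 𝒮.Ω) : Set (NNSpace 𝒜 m N 𝒮.measurements) :=
  {f | IsOptimalMap A (𝒮.M₁ T) f.1}

/-- The set `Ξ_D(T)` of the optimal networks with Jacobians bounded by `D` on `A (M₁ T)`. -/
def TrainingProblem.stableOptimalNets {N m : ℕ} {A : RVec N →L[ℝ] RVec m} {ℓ : ℕ}
    (𝒮 : TrainingProblem A ℓ) (𝒜 : Activations) (D : ℝ) (T : 𝒮.Ω) :
    Set (NNSpace 𝒜 m N 𝒮.measurements) :=
  {f | f ∈ 𝒮.optimalNets 𝒜 T ∧ ∀ y ∈ A '' 𝒮.M₁ T, ‖fderiv ℝ f.1 y‖ ≤ D}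

/-- Computational problem a: compute an optimal neural network from a training set. -/
def TrainingProblem.problemA {N m : ℕ} {A : RVec N →L[ℝ] RVec m} {ℓ : ℕ}
    (𝒮 : TrainingProblem A ℓ) (𝒜 : Activations) : CompProblem where
  Dom := 𝒮.Ω
  Idx := Fin ℓ × (Fin N ⊕ Fin m)
  enc := inferInstance
  eval := 𝒮.coord
  separates := 𝒮.coord_separates
  Out := NNSpace 𝒜 m N 𝒮.measurements
  metric := NNSpace.supMetric 𝒜 m N 𝒮.measurements
  sol := 𝒮.optimalNets 𝒜
  name := NNSpace.ofCode 𝒜 m N 𝒮.measurements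

/-- Computational problem b: compute, together with its Jacobian, an optimal neural network whose
Jacobians are bounded by `D`. -/
def TrainingProblem.problemB {N m : ℕ} {A : RVec N →L[ℝ] RVec m} {ℓ : ℕ}
    (𝒮 : TrainingProblem A ℓ) (𝒜 : Activations) (D : ℝ) : CompProblem where
  Dom := 𝒮.Ω
  Idx := Fin ℓ × (Fin N ⊕ Fin m)
  enc := inferInstance
  eval := 𝒮.coord
  separates := 𝒮.coord_separates
  Out := NNSpace 𝒜 m N 𝒮.measurements
  metric := NNSpace.supJacobianMetric 𝒜 m N 𝒮.measurements
  sol := 𝒮.stableOptimalNets 𝒜 D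
  name := NNSpace.ofCode 𝒜 m N 𝒮.measurements

end

/-! The obstruction is an ambiguity along the kernel of `A` whose sign jumps with the training set.
Invertibility of `A A*` gives a linear right inverse `L` of `A`, and `m < N` gives `w` in the kernel
with `‖w‖ = 4ε₁`. On the domain of all `L y + r w`, `0 ≤ r ≤ 1`, the affine map `L + w/2` is optimal
with constant `‖w‖/2 = 2ε₁`. Every optimal `f` has `f 0` within `2ε₁` of `w`; for the domain built
from `-w` it lies within `2ε₁` of `-w`. Optimal maps for the two signs are therefore at least `4ε₁`
apart at zero (`IsOptimalMap.le_edist`).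

The training sets are shifts by `s` of equally spaced points on a segment. The sign is `+` if a pair
is zero, which happens only for `s = 0`, and `-` otherwise. Inexact input cannot separate `s = 0`
from small `s > 0`, so one output would have to serve both signs, which is impossible with error
below `2ε₁`. For randomised algorithms, two events of probability above 1/2 must meet
(`RandomisedGeneralAlgorithm.exists_common_output`).

Conversely, `L` is within `2ε₁` of both `L + w/2` and `L - w/2` on the measurements and has the same
Jacobian. A rational approximation of `L`, printed by a constant program, thus works for every error
above `2ε₁`. Disjointness of the classes holds because a Turing algorithm is a general algorithm,
which is a randomised one with a Dirac measure. -/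

/-! ### Oracle programs as general algorithms, and lower bounds for randomised algorithms. -/

section GeneralAlgorithms

/-- A halting computation consults the oracle finitely often. In the product topology on `ℕ → ℕ`
this becomes an openness statement, which passes through the program constructors by intersecting
finitely many neighbourhoods. -/
theorem OracleCode.eventually_mem_eval (c : OracleCode) :
    ∀ {o : ℕ → ℕ} {n k : ℕ}, k ∈ c.eval o n → ∀ᶠ o' in nhds o, k ∈ c.eval o' n := by
  induction c with
  | zero => exact fun h => Filter.Eventually.of_forall fun _ => h
  | succ => exact fun h => Filter.Eventually.of_forall fun _ => h
  | left => exact fun h => Filter.Eventually.of_forall fun _ => h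
  | right => exact fun h => Filter.Eventually.of_forall fun _ => h
  | query =>
    intro o n k h
    have hc : Continuous fun o' : ℕ → ℕ => o' n := continuous_apply n
    filter_upwards [hc.continuousAt.eventually_mem
      ((isOpen_discrete {o n}).mem_nhds (Set.mem_singleton _))] with o' ho'
    simpa only [OracleCode.eval, Set.mem_singleton_iff.mp ho'] using h
  | pair cf cg hf hg =>
    intro o n k h
    simp only [OracleCode.eval, Part.mem_bind_iff, Part.mem_map_iff] at h ⊢
    obtain ⟨a, ha, b, hb, rfl⟩ := h
    filter_upwards [hf ha, hg hb] with o' h1 h2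
    exact ⟨a, h1, b, h2, rfl⟩
  | comp cf cg hf hg =>
    intro o n k h
    obtain ⟨a, ha, hk⟩ := Part.mem_bind_iff.mp h
    filter_upwards [hg ha, hf hk] with o' h1 h2
    exact Part.mem_bind_iff.mpr ⟨a, h1, h2⟩
  | prec cf cg hf hg =>
    intro o n k h
    have key : ∀ (z y k : ℕ),
        (k ∈ (Nat.rec (cf.eval o z)
          (fun y ih => ih.bind fun i => cg.eval o (Nat.pair z (Nat.pair y i))) y : Part ℕ)) →
        ∀ᶠ o' in nhds o, k ∈ (Nat.rec (cf.eval o' z)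
          (fun y ih => ih.bind fun i => cg.eval o' (Nat.pair z (Nat.pair y i))) y : Part ℕ) := by
      intro z y
      induction y with
      | zero => exact fun k h => hf h
      | succ y ih =>
        intro k h
        obtain ⟨a, ha, hk⟩ := Part.mem_bind_iff.mp h
        filter_upwards [ih a ha, hg hk] with o' h1 h2
        exact Part.mem_bind_iff.mpr ⟨a, h1, h2⟩
    exact key n.unpair.1 n.unpair.2 k h
  | rfind cf hf =>
    intro o n k h
    obtain ⟨h0, h⟩ := Nat.mem_rfind.mp h
    obtain ⟨a, ha, hk⟩ := (Part.mem_map_iff _).mp h0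
    have h' : ∀ j < k, ∃ b ∈ cf.eval o (Nat.pair n j), decide (b = 0) = false := fun j hj =>
      (Part.mem_map_iff _).mp (h hj)
    choose! b hb hbk using h'
    filter_upwards [hf ha, (Filter.eventually_all_finite (Set.finite_Iio k)).mpr
      fun j hj => hf (hb j hj)] with o' h1 h2
    exact Nat.mem_rfind.mpr ⟨(Part.mem_map_iff _).mpr ⟨a, h1, hk⟩,
      fun {j} hj => (Part.mem_map_iff _).mpr ⟨b j, h2 j hj, hbk j hj⟩⟩

/-- The levels up to which the oracle `o` determines the result of the program `c`. -/
def OracleCode.determiningLevels (c : OracleCode) (o : ℕ → ℕ) : Set ℕ :=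
  {M | ∀ o' : ℕ → ℕ, (∀ q < M, o' q = o q) → c.eval o' 0 = c.eval o 0}

theorem OracleCode.determiningLevels_nonempty {c : OracleCode} {o : ℕ → ℕ}
    (h : (c.eval o 0).Dom) : (c.determiningLevels o).Nonempty := by
  have hev := c.eventually_mem_eval (Part.get_mem h)
  rw [nhds_pi, Filter.Eventually, Filter.mem_pi] at hev
  obtain ⟨I, hI, t, ht, hsub⟩ := hev
  obtain ⟨M, hM⟩ := hI.bddAbove
  refine ⟨M + 1, fun o' ho' => ?_⟩
  have hmem : o' ∈ I.pi t := fun i hi => by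
    rw [ho' i (Nat.lt_succ_of_le (hM hi))]
    exact mem_of_mem_nhds (ht i)
  exact (Part.eq_some_iff.mpr (hsub hmem)).trans (Part.eq_some_iff.mpr (Part.get_mem h)).symm

/-- The least determining level. -/
noncomputable def OracleCode.use (c : OracleCode) (o : ℕ → ℕ) : ℕ := sInf (c.determiningLevels o)

theorem OracleCode.eval_eq_of_agree {c : OracleCode} {o o' : ℕ → ℕ} (h : (c.eval o 0).Dom)
    (ho : ∀ q < c.use o, o' q = o q) : c.eval o' 0 = c.eval o 0 :=
  Nat.sInf_mem (determiningLevels_nonempty h) o' ho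

theorem OracleCode.determiningLevels_congr {c : OracleCode} {o o' : ℕ → ℕ} {M : ℕ}
    (hM : M ∈ c.determiningLevels o) (ho : ∀ q < M, o' q = o q) : M ∈ c.determiningLevels o' :=
  fun o'' h'' => (hM o'' fun q hq => (h'' q hq).trans (ho q hq)).trans (hM o' ho).symm

/-- The query set of a general algorithm must itself depend only on the answers read. The least
determining level has this property: it is also determining for `o'`, and a smaller level for `o'`
would transfer back to `o`. -/
theorem OracleCode.use_eq_of_agree {c : OracleCode} {o o' : ℕ → ℕ} (h : (c.eval o 0).Dom)
    (ho : ∀ q < c.use o, o' q = o q) : c.use o' = c.use o := by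
  have h1 : c.use o ∈ c.determiningLevels o' :=
    determiningLevels_congr (Nat.sInf_mem (determiningLevels_nonempty h)) ho
  have hle : c.use o' ≤ c.use o := Nat.sInf_le h1
  exact hle.antisymm (Nat.sInf_le (determiningLevels_congr (Nat.sInf_mem ⟨_, h1⟩)
    fun q hq => (ho q (hq.trans_le hle)).symm))

/-- A program for the constant function `k`. -/
def OracleCode.const : ℕ → OracleCode
  | 0 => .zero
  | k + 1 => .comp .succ (OracleCode.const k)

theorem OracleCode.eval_const (o : ℕ → ℕ) (k n : ℕ) :
    (OracleCode.const k).eval o n = Part.some k := by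
  induction k with
  | zero => rfl
  | succ k ih => simp [OracleCode.const, OracleCode.eval, ih]

namespace CompProblem

variable (P : CompProblem)

/-- The evaluations that are read by a Turing algorithm: those below the use of its computation,
and all of them if the computation does not halt. -/
def turingQueries (c : OracleCode) (p : P.InexactDom) : Set (P.Idx × ℕ) :=
  {i | (c.eval (P.oracle p) 0).Dom → ∃ q < c.use (P.oracle p), Encodable.decode q = some i}

theorem InexactDom.oracle_congr {P : CompProblem} {a b : P.InexactDom} {q : ℕ}
    (h : ∀ i, Encodable.decode q = some i → P.delta1.eval i b = P.delta1.eval i a) :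
    P.oracle b q = P.oracle a q := by
  unfold CompProblem.oracle
  rcases hq : (Encodable.decode q : Option (P.Idx × ℕ)) with _ | ⟨i, n⟩
  · rfl
  · have h1 : (b.1.2 i n : ℝ) / 2 ^ n = (a.1.2 i n : ℝ) / 2 ^ n := h (i, n) hq
    have h2 : (2 : ℝ) ^ n ≠ 0 := by positivity
    have h3 : b.1.2 i n = a.1.2 i n := by exact_mod_cast (div_left_inj' h2).mp h1
    simp only [h3]

/-- A non-halting computation counts as reading everything, so agreement then forces equality of the
inputs by separation. -/
theorem turingQueries_agree {c : OracleCode} {a b : P.InexactDom}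
    (h : ∀ i ∈ P.turingQueries c a, P.delta1.eval i b = P.delta1.eval i a) :
    b = a ∨ (c.eval (P.oracle a) 0).Dom ∧
      ∀ q < c.use (P.oracle a), P.oracle b q = P.oracle a q := by
  by_cases hd : (c.eval (P.oracle a) 0).Dom
  · exact .inr ⟨hd, fun q hq => InexactDom.oracle_congr fun i hi => h i fun _ => ⟨q, hq, hi⟩⟩
  · exact .inl (P.delta1.separates b a fun i => h i fun hd' => absurd hd' hd)

open Classical in
/-- The general algorithm given by a Turing algorithm. -/
noncomputable def turingAlgorithm (c : OracleCode) : GeneralAlgorithm P.delta1 where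
  run p := (c.eval (P.oracle p) 0).toOption.bind P.name
  queries := P.turingQueries c
  finite_queries a ha := by
    have hd : (c.eval (P.oracle a) 0).Dom := by
      by_contra hd
      refine ha ?_
      rw [Part.toOption_eq_none_iff.mpr hd]
      rfl
    refine (((Set.finite_Iio (c.use (P.oracle a))).image
      (Encodable.decode (α := P.Idx × ℕ))).preimage
        (Option.some_injective (P.Idx × ℕ)).injOn).subset fun i hi => ?_
    obtain ⟨q, hq, hi⟩ := hi hd
    exact ⟨q, hq, hi⟩
  run_eq a b h := by
    obtain rfl | ⟨hd, ho⟩ := P.turingQueries_agree h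
    · rfl
    · have h1 := OracleCode.eval_eq_of_agree hd ho
      simp only [h1]
  queries_eq a b h := by
    obtain rfl | ⟨hd, ho⟩ := P.turingQueries_agree h
    · rfl
    · unfold turingQueries
      rw [OracleCode.use_eq_of_agree hd ho, OracleCode.eval_eq_of_agree hd ho]

end CompProblem

theorem disjoint_turingComputable_notComputable (ε : ℝ) :
    Disjoint (TuringComputable ε) (NotComputable ε) := by
  rw [Set.disjoint_left]
  rintro P ⟨c, hc⟩ hn
  refine hn ⟨P.turingAlgorithm c, fun p => ?_⟩
  obtain ⟨k, hk, h⟩ := hc p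
  have hrun : (P.turingAlgorithm c).run p = P.name k := by
    classical
    simp only [CompProblem.turingAlgorithm, Part.toOption_eq_some_iff.mpr hk]
    rfl
  rw [hrun]
  exact h

/-- A general algorithm as a randomised general algorithm. -/
noncomputable def GeneralAlgorithm.toRandomised {P : CompProblem} (Γ : GeneralAlgorithm P) :
    RandomisedGeneralAlgorithm P where
  X := {Γ}
  sigma := ⊤
  prob _ := @Measure.dirac _ ⊤ ⟨Γ, rfl⟩
  isProb _ := @Measure.dirac.isProbabilityMeasure _ ⊤ _
  measurable_run _ := @measurable_from_top _ _ P.outBorel _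
  measurable_runtime _ _ := trivial
  consistent _ _ _ _ _ := rfl

theorem notRandomisedComputable_subset (ε : ℝ) :
    NotRandomisedComputable ε ⊆ NotComputable ε := by
  rintro P hP ⟨Γ, hΓ⟩
  refine hP ⟨Γ.toRandomised, fun p => ?_⟩
  have h1 : Γ.toRandomised.prob p
      {Γ' | P.delta1.Approximates ε p (Γ'.1.run p)} = 1 := by
    refine (@Measure.dirac_apply' _ ⊤ _ _ trivial).trans (Set.indicator_of_mem ?_ _)
    exact hΓ p
  rw [h1]
  rw [one_div]
  exact ENNReal.one_half_lt_one

theorem disjoint_turingComputable_notRandomisedComputable (ε : ℝ) :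
    Disjoint (TuringComputable ε) (NotRandomisedComputable ε) :=
  (disjoint_turingComputable_notComputable ε).mono_right (notRandomisedComputable_subset ε)

/-- The value `none` is never an approximation, and on proper outputs the condition is closed
because the distance to a set is continuous. -/
theorem CompProblem.measurableSet_approximates (P : CompProblem) (ε : ℝ) (a : P.Dom) :
    @MeasurableSet _ P.outBorel {r | P.Approximates ε a r} := by
  change @MeasurableSet _ (borel P.Out) (some ⁻¹' {r | P.Approximates ε a r})
  have h : some ⁻¹' {r | P.Approximates ε a r} =
      {x | Metric.infEDist x (P.sol a) ≤ ENNReal.ofReal ε} := by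
    ext x
    simp [CompProblem.Approximates]
  rw [h]
  borelize P.Out
  exact (isClosed_le Metric.continuous_infEDist continuous_const).measurableSet

theorem GeneralAlgorithm.runtime_lt_top {P : CompProblem} (Γ : GeneralAlgorithm P) {a : P.Dom}
    (h : Γ.run a ≠ none) : ∃ n : ℕ, Γ.runtime a ≤ n := by
  obtain ⟨n, hn⟩ := ((Γ.finite_queries a h).image Encodable.encode).bddAbove
  exact ⟨n, iSup₂_le fun i hi => by exact_mod_cast hn (Set.mem_image_of_mem _ hi)⟩

/-- If a randomised general algorithm succeeds with probability greater than `1 / 2` on `a`, then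
for some `n` it does the same on every `b` that agrees with `a` on the first `n` evaluations, and
one of its outputs is an approximation for `a` and for `b`. -/
theorem RandomisedGeneralAlgorithm.exists_common_output {P : CompProblem}
    (R : RandomisedGeneralAlgorithm P) {ε : ℝ}
    (h : ∀ p, 1 / 2 < R.prob p {Γ | P.Approximates ε p (Γ.1.run p)}) (a : P.Dom) :
    ∃ n : ℕ, ∀ b : P.Dom, (∀ i, Encodable.encode i ≤ n → P.eval i a = P.eval i b) →
      ∃ r, P.Approximates ε a r ∧ P.Approximates ε b r := by
  let _ := R.sigma
  have _ := R.isProb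
  have hmeas : ∀ p, MeasurableSet {Γ : R.X | P.Approximates ε p (Γ.1.run p)} := fun p =>
    R.measurable_run p (P.measurableSet_approximates ε p)
  -- Halting runs have finite runtime, so these events exhaust the success event and some `E n`
  -- already has probability above 1/2.
  set E : ℕ → Set R.X := fun n =>
    {Γ | P.Approximates ε a (Γ.1.run a)} ∩ {Γ | Γ.1.runtime a ≤ n} with hE
  have hEmeas : ∀ n, MeasurableSet (E n) := fun n => (hmeas a).inter (R.measurable_runtime n a)
  have hmono : Monotone E := fun i j hij Γ hΓ =>
    ⟨hΓ.1, le_trans (show Γ.1.runtime a ≤ i from hΓ.2) (by exact_mod_cast hij)⟩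
  have hunion : ⋃ n, E n = {Γ : R.X | P.Approximates ε a (Γ.1.run a)} := by
    refine subset_antisymm (Set.iUnion_subset fun n => Set.inter_subset_left) fun Γ hΓ => ?_
    obtain ⟨x, hx, -⟩ := id hΓ
    obtain ⟨n, hn⟩ := Γ.1.runtime_lt_top (a := a) (by rw [hx]; simp)
    exact Set.mem_iUnion.mpr ⟨n, hΓ, hn⟩
  have ha := h a
  rw [← hunion, hmono.measure_iUnion, lt_iSup_iff] at ha
  obtain ⟨n, hn⟩ := ha
  refine ⟨n, fun b hb => ?_⟩
  -- On `E n` only evaluations with code at most `n` are read, so consistency gives `E n` the same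
  -- probability under `b`.
  have hagree : ∀ Γ ∈ E n, ∀ i ∈ Γ.1.queries a, P.eval i a = P.eval i b := by
    intro Γ hΓ i hi
    refine hb i ?_
    have h1 : (Encodable.encode i : ℕ∞) ≤ Γ.1.runtime a :=
      le_iSup₂ (f := fun i (_ : i ∈ Γ.1.queries a) => (Encodable.encode i : ℕ∞)) i hi
    exact_mod_cast h1.trans hΓ.2
  rw [R.consistent a b (E n) (hEmeas n) hagree] at hn
  have hinter : (E n ∩ {Γ : R.X | P.Approximates ε b (Γ.1.run b)}).Nonempty := by
    rw [← Set.not_disjoint_iff_nonempty_inter]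
    intro hdisj
    have h1 : R.prob b (E n ∪ {Γ : R.X | P.Approximates ε b (Γ.1.run b)}) ≤ 1 := prob_le_one
    rw [measure_union hdisj (hmeas b)] at h1
    have h2 := ENNReal.add_lt_add hn (h b)
    rw [ENNReal.add_halves] at h2
    exact absurd h1 (not_le.mpr h2)
  obtain ⟨Γ, hΓ, hΓb⟩ := hinter
  refine ⟨Γ.1.run a, hΓ.1, ?_⟩
  rw [← Γ.1.run_eq a b fun i hi => (hagree Γ hΓ i hi).symm]
  exact hΓb

/-- Rounding uses only half of the permitted error; the other half allows the same answers to be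
given for a nearby input. -/
theorem CompProblem.isInexact_round (P : CompProblem) (a : P.Dom) (i : P.Idx) (n : ℕ) :
    |(round (P.eval i a * 2 ^ n) : ℝ) / 2 ^ n - P.eval i a| ≤ 1 / 2 * (1 / 2 ^ n) := by
  have h2 : (0 : ℝ) < 2 ^ n := by positivity
  have h := abs_sub_round (P.eval i a * 2 ^ n)
  rw [abs_sub_comm] at h
  rw [div_sub' h2.ne', abs_div, abs_of_pos h2, mul_one_div, mul_comm (2 ^ n : ℝ)]
  gcongr

/-- An input `a` that is a limit of inputs whose approximate solutions are not approximate
solutions for `a` is an obstruction to randomised algorithms. -/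
theorem CompProblem.mem_notRandomisedComputable {P : CompProblem} {ε : ℝ} (a : P.Dom)
    (h : ∀ δ > 0, ∃ b : P.Dom, (∀ i, |P.eval i b - P.eval i a| ≤ δ) ∧
      ∀ r, P.Approximates ε a r → ¬ P.Approximates ε b r) :
    P ∈ NotRandomisedComputable ε := by
  rintro ⟨R, hR⟩
  have hround : P.IsInexact a fun i n => round (P.eval i a * 2 ^ n) := fun i n =>
    (P.isInexact_round a i n).trans (by
      have : (0 : ℝ) < 1 / 2 ^ n := by positivity
      linarith)
  obtain ⟨n, hn⟩ := R.exists_common_output hR ⟨(a, _), hround⟩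
  obtain ⟨b, hb, hab⟩ := h (1 / 2 * (1 / 2 ^ n)) (by positivity)
  -- The oracle for `b` imitates the one for `a` up to precision `n`, where the perturbation fits
  -- into the spare half of the tolerance.
  have hb' : P.IsInexact b fun i k =>
      if k ≤ n then round (P.eval i a * 2 ^ k) else round (P.eval i b * 2 ^ k) := by
    intro i k
    have hk : (0 : ℝ) < 1 / 2 ^ k := by positivity
    dsimp only
    split_ifs with hkn
    · have h1 := P.isInexact_round a i k
      have h2 := hb i
      have h3 : (1 / 2 ^ n : ℝ) ≤ 1 / 2 ^ k :=
        one_div_pow_le_one_div_pow_of_le one_le_two hkn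
      rw [abs_le] at *
      constructor <;> linarith [h1.1, h1.2, h2.1, h2.2]
    · have h1 := P.isInexact_round b i k
      linarith
  obtain ⟨r, hr, hr'⟩ := hn ⟨(b, _), hb'⟩ (by
    rintro ⟨i, k⟩ hik
    -- The code of `(i, k)` is a Cantor pair, hence at least `k`: evaluations with code at most `n`
    -- have precision at most `n`.
    have hk : k ≤ n := (Nat.right_le_pair _ _).trans hik
    change (round (P.eval i a * 2 ^ k) : ℝ) / 2 ^ k =
      ((if k ≤ n then round (P.eval i a * 2 ^ k) else round (P.eval i b * 2 ^ k) : ℤ) : ℝ) / 2 ^ k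
    rw [if_pos hk])
  exact hab r hr hr'

/-- A single output that approximates solutions for all inputs is computed by a constant
program. -/
theorem CompProblem.mem_turingComputable_of_forall {P : CompProblem} {ε : ℝ} (k : ℕ)
    (h : ∀ a, P.Approximates ε a (P.name k)) : P ∈ TuringComputable ε :=
  ⟨OracleCode.const k, fun p => ⟨k, by rw [OracleCode.eval_const]; exact Part.mem_some k,
    h p.1.1⟩⟩

end GeneralAlgorithms

/-! ### A smooth computable activation function. -/

section Activation

/-- The bounded smooth activation function `x ↦ 1 / (1 + x²)`. -/
noncomputable def inverseQuadratic (x : ℝ) : ℝ := 1 / (1 + x ^ 2)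

theorem contDiff_inverseQuadratic : ContDiff ℝ ∞ inverseQuadratic :=
  contDiff_const.div (by fun_prop) fun x => by positivity

theorem abs_inverseQuadratic_sub_le (x y : ℝ) :
    |inverseQuadratic x - inverseQuadratic y| ≤ |x - y| := by
  have hx : 0 < 1 + x ^ 2 := by positivity
  have hy : 0 < 1 + y ^ 2 := by positivity
  have h : inverseQuadratic x - inverseQuadratic y =
      (y - x) * ((x + y) / ((1 + x ^ 2) * (1 + y ^ 2))) := by
    unfold inverseQuadratic
    field_simp
    ring
  rw [h, abs_mul, abs_sub_comm y x]
  refine mul_le_of_le_one_right (abs_nonneg _) ?_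
  rw [abs_div, abs_of_pos (mul_pos hx hy), div_le_one (mul_pos hx hy), abs_le]
  constructor <;>
    nlinarith [sq_nonneg (x + 1), sq_nonneg (x - 1), sq_nonneg (y + 1), sq_nonneg (y - 1),
      mul_nonneg (sq_nonneg x) (sq_nonneg y)]

/-- The encoding sends `n` to `2n` and `-(n+1)` to `2n+1`, so the absolute value is half the
successor of the code. -/
theorem Int.primrec_natAbs : Primrec Int.natAbs := by
  have h : Primrec fun z : ℤ => (Encodable.encode z + 1) / 2 :=
    Primrec.nat_div.comp (Primrec.succ.comp Primrec.encode) (Primrec.const 2)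
  refine h.of_eq fun z => ?_
  rcases z with n | n
  · change (2 * n + 1) / 2 = n
    omega
  · change (2 * n + 1 + 1) / 2 = n + 1
    omega

theorem Int.primrec_ofNat : Primrec Int.ofNat := by
  refine Primrec.encode_iff.mp ((Primrec.nat_mul.comp (Primrec.const 2) Primrec.id).of_eq
    fun n => ?_)
  rfl

theorem primrec_two_pow : Primrec fun n : ℕ => 2 ^ n := by
  refine (Primrec.nat_rec₁ 1 (f := fun _ i => 2 * i) ?_).of_eq fun n => ?_
  · exact Primrec.nat_mul.comp (Primrec.const 2) Primrec.snd
  · induction n with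
    | zero => rfl
    | succ n ih => simp only [ih]; ring

theorem isComputableRealFun_inverseQuadratic : IsComputableRealFun inverseQuadratic := by
  -- At `p/(q+1)` the value is `(q+1)²/((q+1)²+p²)`; the floor of `2^n` times it errs by less than
  -- one. The 1-Lipschitz bound makes `n` itself a modulus of continuity.
  refine ⟨⟨fun a => Int.ofNat (2 ^ a.2.2 * ((a.2.1 + 1) * (a.2.1 + 1)) /
    ((a.2.1 + 1) * (a.2.1 + 1) + a.1.natAbs * a.1.natAbs)), ?_, ?_⟩,
    Prod.snd, Computable.snd, fun M n x y _ _ h => (abs_inverseQuadratic_sub_le x y).trans h⟩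
  · have hp : Primrec fun a : ℤ × ℕ × ℕ => a.1.natAbs := Int.primrec_natAbs.comp Primrec.fst
    have hq : Primrec fun a : ℤ × ℕ × ℕ => a.2.1 + 1 :=
      Primrec.succ.comp (Primrec.fst.comp Primrec.snd)
    have hn : Primrec fun a : ℤ × ℕ × ℕ => 2 ^ a.2.2 :=
      primrec_two_pow.comp (Primrec.snd.comp Primrec.snd)
    have hqq := Primrec.nat_mul.comp hq hq
    exact (Int.primrec_ofNat.comp (Primrec.nat_div.comp (Primrec.nat_mul.comp hn hqq)
      (Primrec.nat_add.comp hqq (Primrec.nat_mul.comp hp hp)))).to_comp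
  · intro p q n
    set a : ℕ := 2 ^ n * ((q + 1) * (q + 1)) with ha
    set b : ℕ := (q + 1) * (q + 1) + p.natAbs * p.natAbs with hb
    have hq : (0 : ℝ) < q + 1 := by positivity
    have h2 : (0 : ℝ) < 2 ^ n := by positivity
    have hbpos : 0 < b := by positivity
    have hbpos' : (0 : ℝ) < b := by exact_mod_cast hbpos
    have hpp : ((p.natAbs : ℕ) : ℝ) * (p.natAbs : ℕ) = (p : ℝ) * p := by
      rw [Nat.cast_natAbs, Int.cast_abs, abs_mul_abs_self]
    have hb' : (b : ℝ) = (q + 1) * (q + 1) + (p : ℝ) * p := by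
      rw [hb]; push_cast; rw [hpp]
    have hf : inverseQuadratic (p / (q + 1)) = (a / b : ℝ) / 2 ^ n := by
      have : (q + 1) * (q + 1) + (p : ℝ) * p ≠ 0 := hb' ▸ hbpos'.ne'
      have h3 : 1 + ((p : ℝ) / (q + 1)) ^ 2 = ((q + 1) * (q + 1) + (p : ℝ) * p) / (q + 1) ^ 2 := by
        field_simp
      rw [inverseQuadratic, h3, hb', ha]
      push_cast
      field_simp
    have hle : ((a / b : ℕ) : ℝ) ≤ a / b := Nat.cast_div_le
    have hlt : (a / b : ℝ) < (a / b : ℕ) + 1 := by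
      rw [div_lt_iff₀ hbpos']
      exact_mod_cast (Nat.lt_mul_div_succ a hbpos).trans_eq (mul_comm _ _)
    rw [hf, ← sub_div, abs_div, abs_of_pos h2]
    change |(a / b : ℝ) - ((Int.ofNat (a / b) : ℤ) : ℝ)| / 2 ^ n ≤ _
    gcongr
    rw [Int.ofNat_eq_natCast, Int.cast_natCast, abs_le]
    constructor <;> linarith

/-- The collection of activation functions that contains only `x ↦ 1 / (1 + x²)`. -/
noncomputable def inverseQuadraticActivations : Activations where
  size := 1
  fn _ := inverseQuadratic
  computable _ := isComputableRealFun_inverseQuadratic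
  smooth _ := contDiff_inverseQuadratic

end Activation

/-! ### Affine networks and their rational codes. -/

section AffineNetworks

/-- The network without hidden layers that computes `y ↦ R y + b`. -/
def NeuralNetwork.affine (𝒜 : Activations) {m N : ℕ} (R : Matrix (Fin N) (Fin m) ℝ)
    (b : Fin N → ℝ) : NeuralNetwork 𝒜 m N where
  width := m
  hidden := .nil m
  W := 0
  R := R
  bias := b

theorem NeuralNetwork.exists_toFun_eq (𝒜 : Activations) {m N : ℕ} (L : RVec m →L[ℝ] RVec N)
    (b : RVec N) : ∃ Φ : NeuralNetwork 𝒜 m N, (fun y => L y + b) = Φ.toFun := by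
  refine ⟨.affine 𝒜 (Matrix.toEuclideanLin.symm L.toLinearMap) b.ofLp, funext fun y => ?_⟩
  have h : L y = Matrix.toEuclideanLin (Matrix.toEuclideanLin.symm L.toLinearMap) y := by
    rw [LinearEquiv.apply_symm_apply]; rfl
  rw [h, Matrix.toLpLin_apply]
  change _ = WithLp.toLp 2 ((0 : Matrix (Fin N) (Fin m) ℝ).mulVec y.ofLp +
    (Matrix.toEuclideanLin.symm L.toLinearMap).mulVec y.ofLp + b.ofLp)
  rw [Matrix.zero_mulVec, zero_add, WithLp.toLp_add, WithLp.toLp_ofLp]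

theorem RatCode.denseRange_value : DenseRange RatCode.value := by
  refine (Rat.denseRange_cast (𝕜 := ℝ)).mono ?_
  rintro _ ⟨q, rfl⟩
  -- A code stores the denominator minus one.
  refine ⟨(q.num, q.den - 1), ?_⟩
  have h : ((q.den - 1 : ℕ) : ℝ) + 1 = q.den := by
    exact_mod_cast Nat.sub_add_cancel q.den_pos
  rw [RatCode.value, h, Rat.cast_def]

/-- Linear maps are limits of linear maps with rational matrices. -/
theorem exists_rational_near {m N : ℕ} (L : RVec m →L[ℝ] RVec N) {δ : ℝ} (hδ : 0 < δ) :
    ∃ r : Fin N → Fin m → RatCode,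
      ‖(Matrix.toEuclideanLin (Matrix.of fun i j => (r i j).value)).toContinuousLinearMap - L‖
        < δ := by
  let Ψ : (Fin N → Fin m → ℝ) →ₗ[ℝ] (RVec m →L[ℝ] RVec N) :=
    LinearMap.toContinuousLinearMap.toLinearMap ∘ₗ Matrix.toEuclideanLin.toLinearMap ∘ₗ
      (Matrix.ofLinearEquiv ℝ).toLinearMap
  have hΨ : Continuous Ψ := Ψ.continuous_of_finiteDimensional
  have hdense : DenseRange (Pi.map fun _ : Fin N => Pi.map fun _ : Fin m => RatCode.value) :=
    .piMap fun _ => .piMap fun _ => RatCode.denseRange_value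
  have hmem : (Matrix.of.symm (Matrix.toEuclideanLin.symm L.toLinearMap)) ∈
      Ψ ⁻¹' Metric.ball L δ := by
    have : Ψ (Matrix.of.symm (Matrix.toEuclideanLin.symm L.toLinearMap)) = L := by
      ext1 y
      simp [Ψ]
    rw [Set.mem_preimage, this]
    exact Metric.mem_ball_self hδ
  obtain ⟨r, hr⟩ := hdense.exists_mem_open (Metric.isOpen_ball.preimage hΨ) ⟨_, hmem⟩
  refine ⟨r, ?_⟩
  rw [← dist_eq_norm]
  exact hr

/-- The code of the network without hidden layers that computes a rational linear map. -/
def linearCode {m N : ℕ} (r : Fin N → Fin m → RatCode) : NetworkCode :=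
  ([], List.ofFn fun i => ([], List.ofFn (r i), (0, 0)))

theorem exists_network_linearCode (𝒜 : Activations) {m N : ℕ} (r : Fin N → Fin m → RatCode) :
    ∃ Φ : NeuralNetwork 𝒜 m N, NetworkCode.network 𝒜 m N (linearCode r) = some Φ ∧
      Φ.toFun = (Matrix.toEuclideanLin
        (Matrix.of fun i j => (r i j).value)).toContinuousLinearMap := by
  refine ⟨_, rfl, funext fun y => ?_⟩
  rw [LinearMap.coe_toContinuousLinearMap', Matrix.toLpLin_apply]
  have h1 : ∀ i : Fin N, (linearCode r).2.getD i ([], [], (0, 0)) =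
      ([], List.ofFn (r i), (0, 0)) := fun i => by simp [linearCode]
  have h2 : ∀ (i : Fin N) (j : Fin m), weightAt (List.ofFn (r i)) j = (r i j).value :=
    fun i j => by simp [weightAt]
  have h3 : ∀ j : ℕ, weightAt [] j = 0 := fun j => by simp [weightAt, RatCode.value]
  unfold NeuralNetwork.toFun
  congr 1
  simp only [h1, h2, h3]
  ext i
  simp [Matrix.mulVec, dotProduct, RatCode.value]

/-- The operator norm of `R - L` controls values on the unit ball and Jacobians at once, so one code
serves both problems. Boundedness of `Y` ensures that the code names an element of the space. -/
theorem NNSpace.exists_ofCode_linear (𝒜 : Activations) {m N : ℕ} {Y : Set (RVec m)}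
    (hY : Bornology.IsBounded Y) (L : RVec m →L[ℝ] RVec N) {δ : ℝ} (hδ : 0 < δ) :
    ∃ (k : ℕ) (F : NNSpace 𝒜 m N Y) (R : RVec m →L[ℝ] RVec N),
      NNSpace.ofCode 𝒜 m N Y k = some F ∧ F.1 = R ∧ ‖R - L‖ < δ := by
  obtain ⟨r, hr⟩ := exists_rational_near L hδ
  obtain ⟨Φ, hΦ, hfun⟩ := exists_network_linearCode 𝒜 r
  have hb : Bornology.IsBounded (Φ.toFun '' Y) := by
    rw [hfun]
    exact ContinuousLinearMap.lipschitz _ |>.isBounded_image hY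
  refine ⟨Encodable.encode (linearCode r), ⟨Φ.toFun, ⟨Φ, rfl⟩, hb⟩, _, ?_, hfun, hr⟩
  simp [NNSpace.ofCode, hΦ, hb]

end AffineNetworks

/-! ### Inverse problems that are ambiguous along a kernel direction. -/

section AmbiguousDomain

variable {N m : ℕ} {A : RVec N →L[ℝ] RVec m} {L : RVec m →L[ℝ] RVec N} {w : RVec N}

/-- The measurements of size at most one that are reconstructed by `L` in the unit ball. -/
def unitMeasurements (L : RVec m →L[ℝ] RVec N) : Set (RVec m) := {y | ‖y‖ ≤ 1 ∧ ‖L y‖ ≤ 1}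

/-- The domain of all points `L y + r w` with `0 ≤ r ≤ 1`. If `L` is a right inverse of `A` and
`A w = 0`, then a point is determined by its measurement `y` only up to the multiple of `w`. -/
def ambiguousDomain (L : RVec m →L[ℝ] RVec N) (w : RVec N) : Set (RVec N) :=
  {x | ∃ y ∈ unitMeasurements L, ∃ r ∈ Set.Icc (0 : ℝ) 1, x = L y + r • w}

theorem mem_ambiguousDomain {y : RVec m} (hy : y ∈ unitMeasurements L) (w : RVec N) :
    L y ∈ ambiguousDomain L w :=
  ⟨y, hy, 0, by simp, by simp⟩

theorem zero_mem_unitMeasurements (L : RVec m →L[ℝ] RVec N) : 0 ∈ unitMeasurements L := by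
  simp [unitMeasurements]

theorem image_ambiguousDomain (hAL : ∀ y, A (L y) = y) (hw : A w = 0) :
    A '' ambiguousDomain L w = unitMeasurements L := by
  ext y
  constructor
  · rintro ⟨_, ⟨y, hy, r, -, rfl⟩, rfl⟩
    simpa [hAL, hw] using hy
  · exact fun hy => ⟨L y, mem_ambiguousDomain hy w, hAL y⟩

theorem edist_midpoint_le (y : RVec m) {r : ℝ} (hr : r ∈ Set.Icc (0 : ℝ) 1) :
    edist (L y + (1 / 2 : ℝ) • w) (L y + r • w) ≤ ENNReal.ofReal (‖w‖ / 2) := by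
  rw [edist_add_left, edist_dist, dist_eq_norm, ← sub_smul, norm_smul, Real.norm_eq_abs]
  refine ENNReal.ofReal_le_ofReal ?_
  have h : |1 / 2 - r| ≤ 1 / 2 := by
    rw [abs_le]; constructor <;> linarith [hr.1, hr.2]
  nlinarith [norm_nonneg w]

theorem optConst_ambiguousDomain_le (hAL : ∀ y, A (L y) = y) (hw : A w = 0) :
    optConst A (ambiguousDomain L w) ≤ ENNReal.ofReal (‖w‖ / 2) := by
  refine iInf_le_of_le (fun y => {L y + (1 / 2 : ℝ) • w}) (iSup₂_le ?_)
  rintro _ ⟨y, -, r, hr, rfl⟩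
  rw [Metric.hausdorffEDist_singleton]
  simp only [map_add, map_smul, hAL, hw, smul_zero, add_zero]
  exact edist_midpoint_le y hr

/-- The points `0` and `w` have the same measurement, so a single set `φ 0` must be close to both;
the triangle inequality gives `‖w‖ ≤ 2c`. -/
theorem le_optConst_ambiguousDomain (hw : A w = 0) :
    ENNReal.ofReal (‖w‖ / 2) ≤ optConst A (ambiguousDomain L w) := by
  refine le_iInf fun φ => ?_
  set c := ⨆ x ∈ ambiguousDomain L w, Metric.hausdorffEDist (φ (A x)) {x}
  have hle : ∀ x ∈ ambiguousDomain L w, Metric.hausdorffEDist (φ (A x)) {x} ≤ c := fun x hx =>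
    le_iSup₂ (f := fun x (_ : x ∈ ambiguousDomain L w) => Metric.hausdorffEDist (φ (A x)) {x}) x hx
  have h0 := hle 0 ⟨0, zero_mem_unitMeasurements L, 0, by simp, by simp⟩
  have h1 := hle w ⟨0, zero_mem_unitMeasurements L, 1, by simp, by simp⟩
  rw [hw] at h1
  rw [map_zero] at h0
  have h : ENNReal.ofReal ‖w‖ ≤ c + c := by
    calc ENNReal.ofReal ‖w‖ = Metric.hausdorffEDist {(0 : RVec N)} {w} := by
          rw [Metric.hausdorffEDist_singleton, edist_dist, dist_zero_left]
      _ ≤ Metric.hausdorffEDist {0} (φ 0) + Metric.hausdorffEDist (φ 0) {w} :=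
          Metric.hausdorffEDist_triangle
      _ ≤ c + c := add_le_add (Metric.hausdorffEDist_comm.trans_le h0) h1
  rw [ENNReal.ofReal_div_of_pos two_pos]
  refine ENNReal.div_le_of_le_mul ?_
  simpa [mul_two] using h

theorem isOptimalMap_ambiguousDomain (hAL : ∀ y, A (L y) = y) (hw : A w = 0) :
    IsOptimalMap A (ambiguousDomain L w) fun y => L y + (1 / 2 : ℝ) • w := by
  refine le_trans (iSup₂_le ?_) (le_optConst_ambiguousDomain hw)
  rintro _ ⟨y, -, r, hr, rfl⟩
  rw [Metric.hausdorffEDist_singleton]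
  simp only [map_add, map_smul, hAL, hw, smul_zero, add_zero]
  exact edist_midpoint_le y hr

/-- The worst-case bound is tested at the endpoint `x = w`, whose measurement is zero. -/
theorem IsOptimalMap.edist_zero_le (hAL : ∀ y, A (L y) = y) (hw : A w = 0) {f : RVec m → RVec N}
    (hf : IsOptimalMap A (ambiguousDomain L w) f) :
    edist (f 0) w ≤ ENNReal.ofReal (‖w‖ / 2) := by
  have h := (le_iSup₂ (f := fun x (_ : x ∈ ambiguousDomain L w) =>
    Metric.hausdorffEDist {f (A x)} {x}) w
      ⟨0, zero_mem_unitMeasurements L, 1, by simp, by simp⟩).trans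
        (le_trans hf (optConst_ambiguousDomain_le hAL hw))
  rwa [Metric.hausdorffEDist_singleton, hw] at h

/-- Optimal maps for the directions of ambiguity `w` and `-w` are far from each other. -/
theorem IsOptimalMap.le_edist (hAL : ∀ y, A (L y) = y) (hw : A w = 0) {f g : RVec m → RVec N}
    (hf : IsOptimalMap A (ambiguousDomain L w) f)
    (hg : IsOptimalMap A (ambiguousDomain L (-w)) g) :
    ENNReal.ofReal ‖w‖ ≤ edist (f 0) (g 0) := by
  have h1 := hf.edist_zero_le hAL hw
  have h2 := hg.edist_zero_le hAL (by rw [map_neg, hw, neg_zero])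
  rw [norm_neg] at h2
  rw [edist_dist] at *
  rw [ENNReal.ofReal_le_ofReal_iff (by positivity)] at h1 h2
  refine ENNReal.ofReal_le_ofReal ?_
  -- The centres are `2‖w‖` apart and the two balls have radius `‖w‖/2`, leaving a gap of `‖w‖`.
  have h3 : dist w (-w) = 2 * ‖w‖ := by
    rw [dist_eq_norm, sub_neg_eq_add, ← two_smul ℝ w, norm_smul]; norm_num
  have h4 := dist_triangle4 w (f 0) (g 0) (-w)
  rw [dist_comm w (f 0)] at h4
  linarith

end AmbiguousDomain

/-! ### Training sets on a segment, shifted by a parameter. -/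

section TrainingSets

variable {N m : ℕ} {L : RVec m →L[ℝ] RVec N} {y₀ : RVec m} {ℓ : ℕ}

open Classical in
/-- The training set of the pairs `(L y, y)` with `y = ((k + s) / ℓ) y₀` for `k < ℓ`. -/
noncomputable def segmentTraining (L : RVec m →L[ℝ] RVec N) (y₀ : RVec m) (ℓ : ℕ) (s : ℝ) :
    Finset (RVec N × RVec m) :=
  Finset.univ.image fun k : Fin ℓ => (L ((((k : ℝ) + s) / ℓ) • y₀), (((k : ℝ) + s) / ℓ) • y₀)

theorem mem_segmentTraining {s : ℝ} {p : RVec N × RVec m} :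
    p ∈ segmentTraining L y₀ ℓ s ↔
      ∃ k : Fin ℓ, (L ((((k : ℝ) + s) / ℓ) • y₀), (((k : ℝ) + s) / ℓ) • y₀) = p := by
  simp [segmentTraining]

theorem segment_param_injective {s : ℝ} {i k : Fin ℓ}
    (h : ((i : ℝ) + s) / ℓ = ((k : ℝ) + s) / ℓ) : i = k := by
  have hℓ : (ℓ : ℝ) ≠ 0 := by exact_mod_cast (Fin.pos i).ne'
  rw [div_left_inj' hℓ, add_left_inj] at h
  exact Fin.ext (by exact_mod_cast h)

theorem segment_param_mem {s : ℝ} (hs : s ∈ Set.Ico (0 : ℝ) 1) (k : Fin ℓ) :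
    0 ≤ ((k : ℝ) + s) / ℓ ∧ ((k : ℝ) + s) / ℓ ≤ 1 := by
  have hℓ : (0 : ℝ) < ℓ := by exact_mod_cast Fin.pos k
  have hk : (k : ℝ) + 1 ≤ ℓ := by exact_mod_cast k.2
  refine ⟨div_nonneg (add_nonneg (Nat.cast_nonneg _) hs.1) hℓ.le, (div_le_one hℓ).mpr ?_⟩
  linarith [hs.2]

theorem card_segmentTraining (hy₀ : y₀ ≠ 0) (s : ℝ) : (segmentTraining L y₀ ℓ s).card = ℓ := by
  rw [segmentTraining, Finset.card_image_of_injective, Finset.card_univ, Fintype.card_fin]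
  intro i k h
  exact segment_param_injective (smul_left_injective ℝ hy₀ (Prod.ext_iff.mp h).2)

theorem smul_mem_unitMeasurements (hy₀ : y₀ ∈ unitMeasurements L) {t : ℝ} (h0 : 0 ≤ t)
    (h1 : t ≤ 1) : t • y₀ ∈ unitMeasurements L := by
  constructor
  · rw [norm_smul, Real.norm_of_nonneg h0]
    exact mul_le_one₀ h1 (norm_nonneg _) hy₀.1
  · rw [map_smul, norm_smul, Real.norm_of_nonneg h0]
    exact mul_le_one₀ h1 (norm_nonneg _) hy₀.2

theorem zero_mem_segmentTraining (hℓ : 0 < ℓ) : 0 ∈ segmentTraining L y₀ ℓ 0 :=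
  mem_segmentTraining.mpr ⟨⟨0, hℓ⟩, by simp⟩

theorem zero_notMem_segmentTraining (hy₀ : y₀ ≠ 0) {s : ℝ} (hs : 0 < s) :
    0 ∉ segmentTraining L y₀ ℓ s := by
  rw [mem_segmentTraining]
  rintro ⟨k, hk⟩
  have hℓ : (0 : ℝ) < ℓ := by exact_mod_cast Fin.pos k
  have h1 := (smul_eq_zero.mp (Prod.ext_iff.mp hk).2).resolve_right hy₀
  have h2 : 0 < ((k : ℝ) + s) / ℓ := by positivity
  exact h2.ne' h1

/-- If the first non-zero coordinate of `L y₀` is positive, then the points of the training set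
are enumerated in the lexicographic order. -/
theorem lexElem_segmentTraining {i₀ : Fin N} (hi₀ : ∀ j < i₀, L y₀ j = 0) (hpos : 0 < L y₀ i₀)
    {s : ℝ} (h : (segmentTraining L y₀ ℓ s).card = ℓ) (k : Fin ℓ) :
    lexElem (segmentTraining L y₀ ℓ s) h k =
      (L ((((k : ℝ) + s) / ℓ) • y₀), (((k : ℝ) + s) / ℓ) • y₀) := by
  have hcard : ((segmentTraining L y₀ ℓ s).map (lexEquiv N m).toEmbedding).card = ℓ := by
    rw [Finset.card_map, h]
  -- A strictly increasing enumeration is unique. Here the order is decided at coordinate `i₀` of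
  -- the reconstruction, the first one that varies with `k`.
  have huniq := Finset.orderEmbOfFin_unique hcard (f := fun k : Fin ℓ => lexEquiv N m
    (L ((((k : ℝ) + s) / ℓ) • y₀), (((k : ℝ) + s) / ℓ) • y₀))
    (fun k => Finset.mem_map_of_mem _ (mem_segmentTraining.mpr ⟨k, rfl⟩)) (by
      intro i k hik
      have hℓ : (0 : ℝ) < ℓ := by exact_mod_cast Fin.pos i
      have hlt : ((i : ℝ) + s) / ℓ < ((k : ℝ) + s) / ℓ := by gcongr; exact_mod_cast hik
      refine Prod.Lex.toLex_lt_toLex.mpr (.inl ⟨i₀, fun j hj => ?_, ?_⟩)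
      · change L (_ • y₀) j = L (_ • y₀) j
        simp [hi₀ j hj]
      · change L (_ • y₀) i₀ < L (_ • y₀) i₀
        simpa using mul_lt_mul_of_pos_right hlt hpos)
  unfold lexElem
  rw [← congrFun huniq k, Equiv.symm_apply_apply]

end TrainingSets

/-! ### The training problem and its common lower bound. -/

section AmbiguousTrainingProblem

variable {N m : ℕ} {A : RVec N →L[ℝ] RVec m} {L : RVec m →L[ℝ] RVec N} {y₀ : RVec m}

open Classical in
/-- The training sets are `segmentTraining L y₀ ℓ s` with `0 ≤ s < 1`. The domain is ambiguous in
the direction `w` if the training set contains zero, and in the direction `-w` otherwise. -/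
noncomputable def ambiguousTraining (hAL : ∀ y, A (L y) = y) (w : RVec N) (hy₀ : y₀ ≠ 0)
    (hy : y₀ ∈ unitMeasurements L) (ℓ : ℕ) : TrainingProblem A ℓ where
  Ω := segmentTraining L y₀ ℓ '' Set.Ico 0 1
  M₁ T := if 0 ∈ T then ambiguousDomain L w else ambiguousDomain L (-w)
  card_eq := by
    rintro _ ⟨s, -, rfl⟩
    exact card_segmentTraining hy₀ s
  norm_le := by
    rintro _ ⟨s, hs, rfl⟩ p hp
    obtain ⟨k, rfl⟩ := mem_segmentTraining.mp hp
    exact (smul_mem_unitMeasurements hy (segment_param_mem hs k).1 (segment_param_mem hs k).2).symm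
  mem_domain := by
    rintro _ ⟨s, hs, rfl⟩ p hp
    obtain ⟨k, rfl⟩ := mem_segmentTraining.mp hp
    have h := smul_mem_unitMeasurements hy (segment_param_mem hs k).1 (segment_param_mem hs k).2
    refine ⟨?_, (hAL _).symm⟩
    split_ifs
    · exact mem_ambiguousDomain h w
    · exact mem_ambiguousDomain h (-w)

variable {hAL : ∀ y, A (L y) = y} {w : RVec N} {hy₀ : y₀ ≠ 0} {hy : y₀ ∈ unitMeasurements L}
  {ℓ : ℕ}

/-- The training set with parameter `s`. -/
noncomputable def ambiguousTraining.point (hAL : ∀ y, A (L y) = y) (w : RVec N) (hy₀ : y₀ ≠ 0)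
    (hy : y₀ ∈ unitMeasurements L) (ℓ : ℕ) (s : Set.Ico (0 : ℝ) 1) :
    (ambiguousTraining hAL w hy₀ hy ℓ).Ω :=
  ⟨segmentTraining L y₀ ℓ s, s, s.2, rfl⟩

theorem ambiguousTraining_M₁ (T : Finset (RVec N × RVec m)) :
    ∃ w', (w' = w ∨ w' = -w) ∧
      (ambiguousTraining hAL w hy₀ hy ℓ).M₁ T = ambiguousDomain L w' := by
  by_cases h : 0 ∈ T
  · exact ⟨w, .inl rfl, if_pos h⟩
  · exact ⟨-w, .inr rfl, if_neg h⟩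

/-- Both signs of `w` give the same measurement set, as `A` kills `w`. -/
theorem ambiguousTraining_measurements (hw : A w = 0) :
    (ambiguousTraining hAL w hy₀ hy ℓ).measurements = unitMeasurements L := by
  have h : ∀ T, A '' (ambiguousTraining hAL w hy₀ hy ℓ).M₁ T = unitMeasurements L := by
    intro T
    obtain ⟨w', hw', hM⟩ := ambiguousTraining_M₁ (hAL := hAL) (w := w) (hy₀ := hy₀) (hy := hy)
      (ℓ := ℓ) T
    rw [hM, image_ambiguousDomain hAL]
    rcases hw' with rfl | rfl <;> simp [hw]
  unfold TrainingProblem.measurements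
  simp only [h]
  have hne : (ambiguousTraining hAL w hy₀ hy ℓ).Ω.Nonempty := ⟨_, 0, by simp, rfl⟩
  exact Set.biUnion_const hne _

theorem isBounded_ambiguousTraining_measurements (hw : A w = 0) :
    Bornology.IsBounded (ambiguousTraining hAL w hy₀ hy ℓ).measurements := by
  rw [ambiguousTraining_measurements hw]
  exact Metric.isBounded_closedBall.subset fun y hy => mem_closedBall_zero_iff.mpr hy.1

/-- Since the lexicographic enumeration follows `k` for every `s`, a shift moves each evaluation by
`s/ℓ` times a coordinate of size at most one. The evaluations are thus continuous at `s = 0`, while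
the domain jumps there. -/
theorem abs_coord_sub_le {i₀ : Fin N} (hi₀ : ∀ j < i₀, L y₀ j = 0) (hpos : 0 < L y₀ i₀)
    (s : Set.Ico (0 : ℝ) 1) (i : Fin ℓ × (Fin N ⊕ Fin m)) :
    |(ambiguousTraining hAL w hy₀ hy ℓ).coord i (ambiguousTraining.point hAL w hy₀ hy ℓ s) -
      (ambiguousTraining hAL w hy₀ hy ℓ).coord i
        (ambiguousTraining.point hAL w hy₀ hy ℓ ⟨0, by simp⟩)| ≤ s := by
  have key : ∀ (k : Fin ℓ) (c : ℝ), |c| ≤ 1 →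
      |((k : ℝ) + s) / ℓ * c - ((k : ℝ) + 0) / ℓ * c| ≤ s := by
    intro k c hc
    have hℓ : (1 : ℝ) ≤ ℓ := by exact_mod_cast Fin.pos k
    have hs := s.2.1
    have h : ((k : ℝ) + s) / ℓ * c - ((k : ℝ) + 0) / ℓ * c = s / ℓ * c := by ring
    rw [h, abs_mul, abs_of_nonneg (by positivity)]
    exact (mul_le_of_le_one_right (by positivity) hc).trans (div_le_self hs hℓ)
  obtain ⟨k, j | j⟩ := i
  · simp only [TrainingProblem.coord, ambiguousTraining.point]
    rw [lexElem_segmentTraining hi₀ hpos, lexElem_segmentTraining hi₀ hpos]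
    simpa using key k (L y₀ j) ((PiLp.norm_apply_le _ j).trans hy.2)
  · simp only [TrainingProblem.coord, ambiguousTraining.point]
    rw [lexElem_segmentTraining hi₀ hpos, lexElem_segmentTraining hi₀ hpos]
    simpa using key k (y₀ j) ((PiLp.norm_apply_le _ j).trans hy.1)

/-- An output strictly closer than `δ` to both solution sets would yield two solutions less than
`2δ` apart. -/
theorem CompProblem.not_approximates_of_separated {P : CompProblem} {a b : P.Dom} {ε δ : ℝ}
    (hδ : 0 < δ) (hε : ε < δ)
    (h : ∀ f ∈ P.sol a, ∀ g ∈ P.sol b, ENNReal.ofReal (2 * δ) ≤ edist f g) (r : Option P.Out)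
    (ha : P.Approximates ε a r) : ¬ P.Approximates ε b r := by
  rintro ⟨x, rfl, hb⟩
  obtain ⟨x', hx', ha⟩ := ha
  obtain rfl := Option.some_injective _ hx'
  have hlt := (ENNReal.ofReal_lt_ofReal_iff hδ).mpr hε
  obtain ⟨f, hf, hxf⟩ := Metric.infEDist_lt_iff.mp (ha.trans_lt hlt)
  obtain ⟨g, hg, hxg⟩ := Metric.infEDist_lt_iff.mp (hb.trans_lt hlt)
  have h1 := (h f hf g hg).trans (edist_triangle_left f g x)
  rw [two_mul, ENNReal.ofReal_add hδ.le hδ.le] at h1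
  exact absurd h1 (not_le.mpr (ENNReal.add_lt_add hxf hxg))

/-- A common lower bound: no problem on these training sets whose solutions are optimal maps, at a
distance that controls the value at zero, is solved up to an error below `‖w‖ / 2`. -/
theorem mem_notRandomisedComputable_of_optimal {i₀ : Fin N} (hi₀ : ∀ j < i₀, L y₀ j = 0)
    (hpos : 0 < L y₀ i₀) (hw : A w = 0) (hw0 : w ≠ 0) (hℓ : 0 < ℓ) (P : CompProblem)
    (dom : (ambiguousTraining hAL w hy₀ hy ℓ).Ω → P.Dom)
    (idx : P.Idx → Fin ℓ × (Fin N ⊕ Fin m))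
    (heval : ∀ i T, P.eval i (dom T) = (ambiguousTraining hAL w hy₀ hy ℓ).coord (idx i) T)
    (out : P.Out → RVec m → RVec N)
    (hsol : ∀ T, ∀ f ∈ P.sol (dom T),
      IsOptimalMap A ((ambiguousTraining hAL w hy₀ hy ℓ).M₁ T) (out f))
    (hedist : ∀ f g, edist (out f 0) (out g 0) ≤ edist f g) {ε : ℝ} (hε : ε < ‖w‖ / 2) :
    P ∈ NotRandomisedComputable ε := by
  refine CompProblem.mem_notRandomisedComputable
    (dom (ambiguousTraining.point hAL w hy₀ hy ℓ ⟨0, by simp⟩)) fun δ hδ => ?_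
  -- The cap `1/2` keeps the parameter below one; positivity removes zero from the training set and
  -- flips the sign of `w`.
  have hs0 : 0 < min δ (1 / 2) := by positivity
  refine ⟨dom (ambiguousTraining.point hAL w hy₀ hy ℓ ⟨min δ (1 / 2), hs0.le,
    (min_le_right _ _).trans_lt one_half_lt_one⟩), fun i => ?_, ?_⟩
  · rw [heval, heval]
    exact (abs_coord_sub_le hi₀ hpos _ _).trans (min_le_left _ _)
  · refine CompProblem.not_approximates_of_separated (δ := ‖w‖ / 2)
      (by positivity) hε fun f hf g hg => ?_
    rw [mul_div_cancel₀ _ (two_ne_zero' ℝ)]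
    refine le_trans ?_ (hedist f g)
    refine IsOptimalMap.le_edist hAL hw ?_ ?_
    · convert hsol _ f hf
      exact (if_pos (zero_mem_segmentTraining hℓ)).symm
    · convert hsol _ g hg
      exact (if_neg (zero_notMem_segmentTraining hy₀ hs0)).symm

end AmbiguousTrainingProblem

/-! ### Upper and lower bounds for problems a and b. -/

section PhaseTransitions

variable {N m : ℕ} {A : RVec N →L[ℝ] RVec m} {L : RVec m →L[ℝ] RVec N} {y₀ : RVec m}
  {hAL : ∀ y, A (L y) = y} {w : RVec N} {hy₀ : y₀ ≠ 0} {hy : y₀ ∈ unitMeasurements L} {ℓ : ℕ}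

theorem isBounded_image_affine (L : RVec m →L[ℝ] RVec N) (b : RVec N) {Y : Set (RVec m)}
    (hY : Bornology.IsBounded Y) : Bornology.IsBounded ((fun y => L y + b) '' Y) :=
  (L.lipschitz.add (LipschitzWith.const b)).isBounded_image hY

/-- Whatever the sign, the optimal map is `L` plus half the ambiguity vector, so the linear map `L`
misses it by a constant vector of norm `‖w‖/2` only. -/
theorem exists_optimal_affine (𝒜 : Activations) (hw : A w = 0)
    (T : (ambiguousTraining hAL w hy₀ hy ℓ).Ω) :
    ∃ g : NNSpace 𝒜 m N (ambiguousTraining hAL w hy₀ hy ℓ).measurements, ∃ b : RVec N,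
      ‖b‖ = ‖w‖ / 2 ∧ g.1 = (fun y => L y + b) ∧
        g ∈ (ambiguousTraining hAL w hy₀ hy ℓ).optimalNets 𝒜 T := by
  obtain ⟨w', hw', hM⟩ := ambiguousTraining_M₁ (hAL := hAL) (w := w) (hy₀ := hy₀) (hy := hy)
    (ℓ := ℓ) T.1
  have hA : A w' = 0 := by rcases hw' with rfl | rfl <;> simp [hw]
  have hn : ‖w'‖ = ‖w‖ := by rcases hw' with rfl | rfl <;> simp
  refine ⟨⟨fun y => L y + (1 / 2 : ℝ) • w', NeuralNetwork.exists_toFun_eq 𝒜 L _,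
    isBounded_image_affine L _ (isBounded_ambiguousTraining_measurements hw)⟩, _, ?_, rfl, ?_⟩
  · rw [norm_smul, hn]
    norm_num
    ring
  · change IsOptimalMap A ((ambiguousTraining hAL w hy₀ hy ℓ).M₁ T.1) _
    rw [hM]
    exact isOptimalMap_ambiguousDomain hAL hA

theorem fderiv_affine (L : RVec m →L[ℝ] RVec N) (b : RVec N) (y : RVec m) :
    fderiv ℝ (fun y => L y + b) y = L := by
  rw [fderiv_add_const, L.fderiv]

theorem edist_linear_affine_le {R L : RVec m →L[ℝ] RVec N} {b : RVec N} {y : RVec m}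
    (hy : ‖y‖ ≤ 1) {ε : ℝ} (h : ‖R - L‖ + ‖b‖ ≤ ε) :
    max (edist (R y) (L y + b)) (edist (fderiv ℝ R y) (fderiv ℝ (fun y => L y + b) y)) ≤
      ENNReal.ofReal ε := by
  rw [fderiv_affine, R.fderiv, edist_dist, edist_dist, dist_eq_norm, dist_eq_norm]
  refine max_le (ENNReal.ofReal_le_ofReal ?_) (ENNReal.ofReal_le_ofReal ?_)
  · have h1 : R y - (L y + b) = (R - L) y - b := by
      rw [sub_apply]; abel
    rw [h1]
    have h2 := (R - L).le_of_opNorm_le_of_le le_rfl hy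
    have h3 := norm_sub_le ((R - L) y) b
    linarith
  · linarith [norm_nonneg b]

theorem CompProblem.approximates_of_edist_le {P : CompProblem} {ε : ℝ} {a : P.Dom}
    {r : Option P.Out} {x y : P.Out} (hr : r = some x) (hy : y ∈ P.sol a)
    (h : edist x y ≤ ENNReal.ofReal ε) : P.Approximates ε a r :=
  ⟨x, hr, (Metric.infEDist_le_edist_of_mem hy).trans h⟩

/-- The excess `ε - ‖w‖/2` pays for rounding `L` to rational weights; the resulting network suits
all training sets, so no oracle call is needed. -/
theorem problemA_mem_turingComputable (𝒜 : Activations) (hw : A w = 0) {ε : ℝ}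
    (hε : ‖w‖ / 2 < ε) :
    (ambiguousTraining hAL w hy₀ hy ℓ).problemA 𝒜 ∈ TuringComputable ε := by
  obtain ⟨k, F, R, hk, hF, hR⟩ := NNSpace.exists_ofCode_linear 𝒜
    (isBounded_ambiguousTraining_measurements (hAL := hAL) (hy₀ := hy₀) (hy := hy) (ℓ := ℓ) hw) L
      (sub_pos.mpr hε)
  refine CompProblem.mem_turingComputable_of_forall k fun T => ?_
  obtain ⟨g, b, hb, hg, hopt⟩ := exists_optimal_affine 𝒜 hw T
  refine CompProblem.approximates_of_edist_le
    (P := (ambiguousTraining hAL w hy₀ hy ℓ).problemA 𝒜) hk hopt (iSup₂_le fun y hyY => ?_)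
  rw [ambiguousTraining_measurements hw] at hyY
  rw [hF, hg]
  exact (le_max_left _ _).trans (edist_linear_affine_le hyY.1 (by linarith))

theorem problemB_mem_turingComputable (𝒜 : Activations) (hw : A w = 0) {D ε : ℝ} (hD : ‖L‖ ≤ D)
    (hε : ‖w‖ / 2 < ε) :
    (ambiguousTraining hAL w hy₀ hy ℓ).problemB 𝒜 D ∈ TuringComputable ε := by
  obtain ⟨k, F, R, hk, hF, hR⟩ := NNSpace.exists_ofCode_linear 𝒜
    (isBounded_ambiguousTraining_measurements (hAL := hAL) (hy₀ := hy₀) (hy := hy) (ℓ := ℓ) hw) L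
      (sub_pos.mpr hε)
  refine CompProblem.mem_turingComputable_of_forall k fun T => ?_
  obtain ⟨g, b, hb, hg, hopt⟩ := exists_optimal_affine 𝒜 hw T
  have hmem : g ∈ ((ambiguousTraining hAL w hy₀ hy ℓ).problemB 𝒜 D).sol T := by
    refine ⟨hopt, fun y _ => ?_⟩
    rw [hg, fderiv_affine]
    exact hD
  refine CompProblem.approximates_of_edist_le
    (P := (ambiguousTraining hAL w hy₀ hy ℓ).problemB 𝒜 D) hk hmem (iSup₂_le fun y hyY => ?_)
  rw [ambiguousTraining_measurements hw] at hyY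
  rw [hF, hg]
  exact edist_linear_affine_le hyY.1 (by linarith)

variable {i₀ : Fin N}

/-- Zero is a measurement, so the supremum metric dominates the distance of the values at zero. -/
theorem problemA_mem_notRandomisedComputable (𝒜 : Activations) (hi₀ : ∀ j < i₀, L y₀ j = 0)
    (hpos : 0 < L y₀ i₀) (hw : A w = 0) (hw0 : w ≠ 0) (hℓ : 0 < ℓ) {ε : ℝ} (hε : ε < ‖w‖ / 2) :
    (ambiguousTraining hAL w hy₀ hy ℓ).problemA 𝒜 ∈ NotRandomisedComputable ε := by
  have h0 : 0 ∈ (ambiguousTraining hAL w hy₀ hy ℓ).measurements := by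
    rw [ambiguousTraining_measurements hw]
    exact zero_mem_unitMeasurements L
  exact mem_notRandomisedComputable_of_optimal (hAL := hAL) (hy₀ := hy₀) (hy := hy) hi₀ hpos hw hw0
    hℓ ((ambiguousTraining hAL w hy₀ hy ℓ).problemA 𝒜) id id (fun _ _ => rfl)
    (fun f : NNSpace 𝒜 m N (ambiguousTraining hAL w hy₀ hy ℓ).measurements => f.1) (fun _ _ hf => hf)
    (fun f g => le_iSup₂ (f := fun y (_ : y ∈ (ambiguousTraining hAL w hy₀ hy ℓ).measurements) =>
      edist (f.1 y) (g.1 y)) 0 h0) hε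

theorem problemB_mem_notRandomisedComputable (𝒜 : Activations) (D : ℝ)
    (hi₀ : ∀ j < i₀, L y₀ j = 0) (hpos : 0 < L y₀ i₀) (hw : A w = 0) (hw0 : w ≠ 0) (hℓ : 0 < ℓ)
    {ε : ℝ} (hε : ε < ‖w‖ / 2) :
    (ambiguousTraining hAL w hy₀ hy ℓ).problemB 𝒜 D ∈ NotRandomisedComputable ε := by
  have h0 : 0 ∈ (ambiguousTraining hAL w hy₀ hy ℓ).measurements := by
    rw [ambiguousTraining_measurements hw]
    exact zero_mem_unitMeasurements L
  exact mem_notRandomisedComputable_of_optimal (hAL := hAL) (hy₀ := hy₀) (hy := hy) hi₀ hpos hw hw0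
    hℓ ((ambiguousTraining hAL w hy₀ hy ℓ).problemB 𝒜 D) id id (fun _ _ => rfl)
    (fun f : NNSpace 𝒜 m N (ambiguousTraining hAL w hy₀ hy ℓ).measurements => f.1) (fun _ _ hf => hf.1)
    (fun f g => (le_max_left _ _).trans
      (le_iSup₂ (f := fun y (_ : y ∈ (ambiguousTraining hAL w hy₀ hy ℓ).measurements) =>
        max (edist (f.1 y) (g.1 y)) (edist (fderiv ℝ f.1 y) (fderiv ℝ g.1 y))) 0 h0)) hε

end PhaseTransitions

/-! ### The right inverse, the kernel vector and the segment direction. -/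

section LinearAlgebra

variable {N m : ℕ} {A : RVec N →L[ℝ] RVec m}

/-- Zero is outside the spectrum, so `A A*` is invertible and `A* (A A*)⁻¹` is a right inverse. -/
theorem exists_rightInverse_of_spectrum_pos {a b : ℝ} (ha : 0 < a)
    (h : spectrum ℝ (A ∘L ContinuousLinearMap.adjoint A) ⊆ Set.Icc (a ^ 2) b) :
    ∃ L : RVec m →L[ℝ] RVec N, ∀ y, A (L y) = y := by
  have h0 : (0 : ℝ) ∉ spectrum ℝ (A ∘L ContinuousLinearMap.adjoint A) := fun h0 =>
    absurd (h h0).1 (not_le.mpr (by positivity))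
  obtain ⟨u, hu⟩ := spectrum.zero_notMem_iff ℝ |>.mp h0
  refine ⟨ContinuousLinearMap.adjoint A ∘L (↑u⁻¹ : RVec m →L[ℝ] RVec m), fun y => ?_⟩
  have h1 := congrArg (fun B : RVec m →L[ℝ] RVec m => B y) u.mul_inv
  rw [hu] at h1
  exact h1

theorem exists_ker_norm_eq (A : RVec N →L[ℝ] RVec m) (hmN : m < N) {c : ℝ} (hc : 0 ≤ c) :
    ∃ w : RVec N, A w = 0 ∧ ‖w‖ = c := by
  have hker : LinearMap.ker A.toLinearMap ≠ ⊥ :=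
    LinearMap.ker_ne_bot_of_finrank_lt (by simpa using hmN)
  obtain ⟨v, hv, hv0⟩ := Submodule.exists_mem_ne_zero_of_ne_bot hker
  refine ⟨(c / ‖v‖) • v, ?_, ?_⟩
  · rw [map_smul, show A v = 0 from hv, smul_zero]
  · rw [norm_smul, Real.norm_of_nonneg (by positivity), div_mul_cancel₀ _ (norm_ne_zero_iff.mpr hv0)]

/-- There is a measurement in `unitMeasurements L` for which the first non-zero coordinate of its
reconstruction is positive. -/
theorem exists_lex_positive (L : RVec m →L[ℝ] RVec N) (hL : L ≠ 0) :
    ∃ y ∈ unitMeasurements L, y ≠ 0 ∧ ∃ i, (∀ j < i, L y j = 0) ∧ 0 < L y i := by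
  classical
  obtain ⟨y, hy⟩ : ∃ y, L y ≠ 0 := by
    by_contra! h
    exact hL (ContinuousLinearMap.ext h)
  obtain ⟨i, hi, hmin⟩ : ∃ i, L y i ≠ 0 ∧ ∀ j < i, L y j = 0 := by
    have hne : (Finset.univ.filter fun i => L y i ≠ 0).Nonempty := by
      by_contra h
      refine hy (PiLp.ext fun i => ?_)
      by_contra hi
      exact h ⟨i, by simpa using hi⟩
    refine ⟨_, (Finset.mem_filter.mp (Finset.min'_mem _ hne)).2, fun j hj => ?_⟩
    by_contra h
    exact absurd (Finset.min'_le _ j (by simpa using h)) (not_le.mpr hj)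
  set M := max 1 (max ‖y‖ ‖L y‖)
  have hM : 0 < M := lt_max_of_lt_left one_pos
  have hy1 : ‖y‖ ≤ M := (le_max_left _ _).trans (le_max_right _ _)
  have hLy1 : ‖L y‖ ≤ M := (le_max_right _ _).trans (le_max_right _ _)
  have hy0 : y ≠ 0 := by
    rintro rfl
    exact hy (map_zero L)
  have hsign : |(SignType.sign (L y i) : ℝ)| = 1 := by
    rcases hi.lt_or_gt with h | h <;> simp [h]
  -- Multiplying by the sign makes the leading coordinate positive, and dividing by `M` brings `y`
  -- and `L y` into the unit balls.
  set σ : ℝ := (SignType.sign (L y i) : ℝ)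
  have hσ : ‖σ / M‖ = 1 / M := by
    rw [norm_div, Real.norm_eq_abs, hsign, Real.norm_of_nonneg hM.le]
  have hσ0 : σ ≠ 0 := by
    intro h
    rw [h] at hsign
    simp at hsign
  refine ⟨(σ / M) • y, ⟨?_, ?_⟩, smul_ne_zero (div_ne_zero hσ0 hM.ne') hy0, i,
    fun j hj => by simp [hmin j hj], ?_⟩
  · rw [norm_smul, hσ, one_div_mul_eq_div]
    exact (div_le_one hM).mpr hy1
  · rw [map_smul, norm_smul, hσ, one_div_mul_eq_div]
    exact (div_le_one hM).mpr hLy1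
  · have h : (L ((σ / M) • y)) i = |L y i| / M := by
      rw [map_smul, PiLp.smul_apply, smul_eq_mul, div_mul_eq_mul_div, sign_mul_self]
    rw [h]
    exact div_pos (abs_pos.mpr hi) hM

end LinearAlgebra

theorem mainTheorem3 :
    ∃ 𝒜 : Activations,
      ∀ (N m : ℕ), m < N → ∀ (βmin βmax : ℝ), 0 < βmin → βmin ≤ βmax →
      ∀ A : RVec N →L[ℝ] RVec m, A ≠ 0 →
        spectrum ℝ (A ∘L ContinuousLinearMap.adjoint A) ⊆ Set.Icc (βmin ^ 2) (βmax ^ 2) →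
      ∀ ε₁ : ℚ, 0 < ε₁ → ε₁ ≤ 3 / 8 → ∀ ℓ : ℕ, 2 ≤ ℓ →
      ∃ 𝒮 : TrainingProblem A ℓ,
        HasPhaseTransition TuringComputable NotRandomisedComputable (𝒮.problemA 𝒜)
          (2 * (ε₁ : ℝ)) (ε₁ : ℝ) ∧
        ∃ D : ℕ, 0 < D ∧
          HasSharpPhaseTransition TuringComputable NotComputable (𝒮.problemB 𝒜 D)
            (2 * (ε₁ : ℝ)) := by
  refine ⟨inverseQuadraticActivations, ?_⟩
  intro N m hmN βmin βmax hβ _ A hA hspec ε₁ hε₁ _ ℓ hℓ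
  have hε : (0 : ℝ) < ε₁ := by exact_mod_cast hε₁
  obtain ⟨L, hAL⟩ := exists_rightInverse_of_spectrum_pos hβ hspec
  have hL : L ≠ 0 := by
    rintro rfl
    refine hA (ContinuousLinearMap.ext fun x => ?_)
    rw [← hAL (A x)]
    simp
  -- Norm `4ε₁` places both the error of `L` and the lower bound at `‖w‖/2 = 2ε₁`.
  obtain ⟨w, hw, hwn⟩ := exists_ker_norm_eq A hmN (c := 4 * (ε₁ : ℝ)) (by positivity)
  have hw0 : w ≠ 0 := norm_pos_iff.mp (by rw [hwn]; positivity)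
  have hhalf : ‖w‖ / 2 = 2 * (ε₁ : ℝ) := by rw [hwn]; ring
  obtain ⟨y₀, hy, hy₀, i₀, hi₀, hpos⟩ := exists_lex_positive L hL
  have hℓ0 : 0 < ℓ := by omega
  refine ⟨ambiguousTraining hAL w hy₀ hy ℓ,
    ⟨fun ε _ => disjoint_turingComputable_notRandomisedComputable ε, hε, by linarith,
      fun ε h => problemA_mem_turingComputable _ hw (hhalf.trans_lt h),
      -- The obstruction reaches up to `2ε₁`; the range below `ε₁` is part of it.
      fun ε _ h => problemA_mem_notRandomisedComputable _ hi₀ hpos hw hw0 hℓ0 (by linarith)⟩,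
    -- Any positive integer bounding `‖L‖` serves as `D`, since `L` is the Jacobian of the affine
    -- optimal maps.
    ⌈‖L‖⌉₊ + 1, Nat.succ_pos _,
    ⟨fun ε _ => disjoint_turingComputable_notComputable ε, by linarith, le_rfl,
      fun ε h => problemB_mem_turingComputable _ hw ?_ (hhalf.trans_lt h),
      fun ε _ h => notRandomisedComputable_subset ε
        (problemB_mem_notRandomisedComputable _ _ hi₀ hpos hw hw0 hℓ0 (by linarith))⟩⟩
  push_cast
  linarith [Nat.le_ceil ‖L‖]
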